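/- Let $n\ge 1$ and $d>n$ be integers, let $N=\binom{n+1+d}{n+1}-1$, and let $\mathcal X=\{\sum_{|\beta|=d}A_\beta Z^\beta=0\}\subset\mathbb P^{n+1}\times\mathbb P^{N}$ be the universal hypersurface of degree $d$ over $\mathbb C$, with homogeneous coordinates $[Z_0:\dots:Z_{n+1}]$ on $\mathbb P^{n+1}$ and $[A]=[A_\beta]_{\beta\in\mathbb N^{n+2},\,|\beta|=d}$ on $\mathbb P^N$. Let $J^n_{\rm vert}(\mathcal X)$ be the space of vertical $n$-jets: its points are the pairs consisting of an $n$-jet at $\zeta=0$ of a holomorphic curve $\zeta\mapsto[Z(\zeta)]\in\mathbb P^{n+1}$ and a point $[A]\in\mathbb P^N$ such that $\sum_\beta A_\beta Z(\zeta)^\beta$ vanishes to order $n+1$ at $\zeta=0$ (with the $A_\beta$ constant); equivalently, if $\mathsf D$ denotes the total derivative in $\zeta$, it is given by the $n+1$ equations $\mathsf D^k\big(\sum_\beta A_\beta Z^\beta\big)=0$, $0\le k\le n$, on $J^n(\mathbb C,\mathbb P^{n+1})\times\mathbb P^N$. On the part of $J^n_{\rm vert}(\mathcal X)$ over the standard affine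 chart $\{Z_0\ne0\}\times\{A_{0d0\cdots0}\neq0\}$, with affine coordinates $z_i=Z_i/Z_0$ and jet coordinates $z_i',\dots,z_i^{(n)}$ $(1\le i\le n+1)$, let $\widetilde\Sigma_0=\{z_1'=\dots=z_{n+1}'=0\}$, and let $\widetilde\Sigma$ be the closure of $\widetilde\Sigma_0$ in $J^n_{\rm vert}(\mathcal X)$. Then: (0) In every standard affine chart $\{Z_\upsilon\ne0\}\times\{A_\alpha\ne0\}$, with $t_i=Z_i/Z_\upsilon$ $(i\neq\upsilon)$, the set $\widetilde\Sigma$ is given in $J^n_{\rm vert}(\mathcal X)$ by the equations $t_i'=0$ for all $i\ne\upsilon$. (1) $J^n_{\rm vert}(\mathcal X)\setminus\widetilde\Sigma$ is smooth of pure codimension $n+1$ in $J^n(\mathbb C,\mathbb P^{n+1})\times\mathbb P^N$, that is, of pure dimension $j_n^d:=N+n(n+1)$: near each of its points it is a complex submanifold of that dimension, and its tangent space, the common kernel of the differentials of the $n+1$ defining equations in a chart, has dimension $j_n^d$. (2) The twisted tangent bundle $$T_{J^n_{\rm vert}(\mathcal X)}\otimes\mathcal O_{\mathbb P^{n+1}}(n^2+2n)\otimes\mathcal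 O_{\mathbb P^{N}}(1)$$ is generated by its global sections on $J^n_{\rm vert}(\mathcal X)\setminus\widetilde\Sigma$: for every $p\in J^n_{\rm vert}(\mathcal X)\setminus\widetilde\Sigma$ there are $j_n^d$ global (algebraic) sections $\mathsf T_1,\dots,\mathsf T_{j_n^d}$ of it, defined over all of $J^n_{\rm vert}(\mathcal X)$, whose values at $p$ form a basis of the (twisted) tangent space at $p$: $$\mathbb C\,\mathsf T_1(p)\oplus\cdots\oplus\mathbb C\,\mathsf T_{j_n^d}(p)=T_{J^n_{\rm vert}(\mathcal X),\,p}.$$ Here a global section is a family of regular tangent vector fields on the affine algebraic sets that represent $J^n_{\rm vert}(\mathcal X)$ in the standard charts, related on overlaps by the differential of the change of coordinates multiplied by the transition functions of the two line bundles. -/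

import Mathlib

open scoped PowerSeries

noncomputable section

namespace VertJets

/-- Multi-indices of length `d` in `n + 2` variables, i.e. the monomials of degree `d`
in the homogeneous coordinates of `ℙ^{n+1}`. -/
abbrev MonIdx (n d : ℕ) : Type := {β : Fin (n + 2) → ℕ // ∑ i, β i = d}

instance (n d : ℕ) : Fintype (MonIdx n d) :=
  Fintype.subtype (Finset.piAntidiag Finset.univ d) (by simp [Finset.mem_piAntidiag])

/-- The dimension `N` of the projective space of all degree `d` hypersurfaces of `ℙ^{n+1}`. -/
def paramDim (n d : ℕ) : ℕ := (n + 1 + d).choose (n + 1) - 1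

/-- Homogeneous data: an `n`-jet `ζ ↦ (Z_0(ζ), …, Z_{n+1}(ζ))` in `ℂ^{n+2}`, given by its Taylor
coefficients `w.1 i k = Z_i^{(k)}(0) / k!` for `0 ≤ k ≤ n`, together with the coefficients `A_β` of
a form of degree `d`. -/
abbrev Homog (n d : ℕ) : Type := (Fin (n + 2) → Fin (n + 1) → ℂ) × (MonIdx n d → ℂ)

/-- The Taylor polynomial with prescribed coefficients up to order `n`, as a power series in the
curve parameter. -/
def ser {n : ℕ} (f : Fin (n + 1) → ℂ) : ℂ⟦X⟧ :=
  PowerSeries.mk fun k => if h : k < n + 1 then f ⟨k, h⟩ else 0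

/-- The `k`-th defining equation of vertical jets, `0 ≤ k ≤ n`: the coefficient of order `k`, along
the jet, of `∑_β A_β Z^β` where the `A_β` are constant. This is `1 / k!` times the value of
`D^k (∑_β A_β Z^β)`, where `D` is the total derivative with respect to the curve parameter. -/
def eqn {n d : ℕ} (k : Fin (n + 1)) (w : Homog n d) : ℂ :=
  PowerSeries.coeff (k : ℕ) (∑ β : MonIdx n d, PowerSeries.C (w.2 β) * ∏ i, ser (w.1 i) ^ β.1 i)

/-- Homogeneous representatives of the points of the space of vertical `n`-jets: `[Z(0)]` is a point
of `ℙ^{n+1}`, `[A]` is a point of `ℙ^N`, and the jet satisfies all the defining equations. -/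
abbrev VertRep (n d : ℕ) : Type :=
  {w : Homog n d // (∃ i, w.1 i 0 ≠ 0) ∧ w.2 ≠ 0 ∧ ∀ k, eqn k w = 0}

/-- Two homogeneous data define the same `n`-jet in `ℙ^{n+1}` and the same point of `ℙ^N`: the
curves differ by an invertible function of the parameter (up to order `n`), the coefficients by an
invertible constant. -/
def HomogRel {n d : ℕ} (w w' : Homog n d) : Prop :=
  (∃ g : ℂ⟦X⟧, PowerSeries.constantCoeff g ≠ 0 ∧
    ∀ (i : Fin (n + 2)) (k : Fin (n + 1)),
      w'.1 i k = PowerSeries.coeff (k : ℕ) (g * ser (w.1 i))) ∧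
  ∃ s : ℂ, s ≠ 0 ∧ w'.2 = s • w.2

theorem coeff_ser {n : ℕ} (f : Fin (n + 1) → ℂ) (k : Fin (n + 1)) :
    PowerSeries.coeff (k : ℕ) (ser f) = f k := by
  rw [ser, PowerSeries.coeff_mk, dif_pos k.2]

theorem coeff_mul_congr {n : ℕ} (h a b : ℂ⟦X⟧)
    (hab : ∀ k : Fin (n + 1), PowerSeries.coeff (k : ℕ) a = PowerSeries.coeff (k : ℕ) b)
    (k : Fin (n + 1)) :
    PowerSeries.coeff (k : ℕ) (h * a) = PowerSeries.coeff (k : ℕ) (h * b) := by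
  rw [PowerSeries.coeff_mul, PowerSeries.coeff_mul]
  refine Finset.sum_congr rfl fun q hq => ?_
  have hq' := Finset.HasAntidiagonal.mem_antidiagonal.1 hq
  rw [hab ⟨q.2, by have := k.2; omega⟩]

theorem homogRel_equivalence (n d : ℕ) : Equivalence (@HomogRel n d) where
  refl w := ⟨⟨1, by simp, fun i k => by rw [one_mul, coeff_ser]⟩, 1, one_ne_zero, by simp⟩
  symm := by
    rintro w w' ⟨⟨g, hg, h⟩, s, hs, h'⟩
    refine ⟨⟨g⁻¹, by simpa using hg, fun i k => ?_⟩, s⁻¹, inv_ne_zero hs, by simp [h', hs]⟩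
    rw [coeff_mul_congr g⁻¹ (ser (w'.1 i)) (g * ser (w.1 i))
      (fun k => by rw [coeff_ser, h]), ← mul_assoc, PowerSeries.inv_mul_cancel g hg,
      one_mul, coeff_ser]
  trans := by
    rintro w w' w'' ⟨⟨g, hg, h⟩, s, hs, h'⟩ ⟨⟨g₂, hg₂, h₂⟩, s₂, hs₂, h₂'⟩
    refine ⟨⟨g₂ * g, by simp [hg, hg₂], fun i k => ?_⟩, s₂ * s, mul_ne_zero hs₂ hs, by
      rw [h₂', h', smul_smul]⟩
    rw [h₂, mul_assoc]
    exact coeff_mul_congr g₂ _ _ (fun k => by rw [coeff_ser, h]) k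

instance vertSetoid (n d : ℕ) : Setoid (VertRep n d) :=
  Setoid.comap Subtype.val ⟨HomogRel, homogRel_equivalence n d⟩

/-- The space `J^n_vert(𝒳)` of vertical `n`-jets of the universal hypersurface of degree `d` in
`ℙ^{n+1} × ℙ^N`, with the quotient topology. -/
def VertJet (n d : ℕ) : Type := Quotient (vertSetoid n d)

instance (n d : ℕ) : TopologicalSpace (VertJet n d) :=
  inferInstanceAs (TopologicalSpace (Quotient (vertSetoid n d)))

/-- The standard affine charts `{Z_υ ≠ 0} × {A_α ≠ 0}`. -/
structure Chart (n d : ℕ) where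
  /-- the index of the nonvanishing homogeneous coordinate of `ℙ^{n+1}` -/
  υ : Fin (n + 2)
  /-- the index of the nonvanishing homogeneous coordinate of `ℙ^N` -/
  α : MonIdx n d

/-- The affine coordinates in a chart: the Taylor coefficients of order `0, …, n` of the
`t_i = Z_i / Z_υ`, `i ≠ υ`, and the `a_β = A_β / A_α`, `β ≠ α`. -/
abbrev CoordIdx {n d : ℕ} (c : Chart n d) : Type :=
  ({i : Fin (n + 2) // i ≠ c.υ} × Fin (n + 1)) ⊕ {β : MonIdx n d // β ≠ c.α}

/-- The ambient affine space `ℂ^{(n+1)(n+1)} × ℂ^N` of a chart. -/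
abbrev ChartSpace {n d : ℕ} (c : Chart n d) : Type := CoordIdx c → ℂ

/-- The homogeneous data of a chart point, normalized by `Z_υ = 1` and `A_α = 1`. -/
def incl {n d : ℕ} (c : Chart n d) (p : ChartSpace c) : Homog n d :=
  (fun i k => if h : i = c.υ then (if k = 0 then 1 else 0) else p (Sum.inl (⟨i, h⟩, k)),
   fun β => if h : β = c.α then 1 else p (Sum.inr ⟨β, h⟩))

/-- The affine coordinates, in a chart, of homogeneous data with `Z_υ(0) ≠ 0` and `A_α ≠ 0`. -/
def coord {n d : ℕ} (c : Chart n d) (w : Homog n d) : ChartSpace c :=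
  Sum.elim
    (fun q => PowerSeries.coeff (q.2 : ℕ) (ser (w.1 q.1.1) * (ser (w.1 c.υ))⁻¹))
    (fun β => w.2 β.1 / w.2 c.α)

/-- The change of coordinates from the chart `c` to the chart `c'`. -/
def trans {n d : ℕ} (c c' : Chart n d) (p : ChartSpace c) : ChartSpace c' :=
  coord c' (incl c p)

/-- The vertical jets in a chart: the affine algebraic set cut out by the `n + 1` equations. -/
def chartLocus {n d : ℕ} (c : Chart n d) : Set (ChartSpace c) :=
  {p | ∀ k, eqn k (incl c p) = 0}

/-- The point of `J^n_vert(𝒳)` with given coordinates in the chart `c`. -/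
def chartPoint {n d : ℕ} (c : Chart n d) (p : chartLocus c) : VertJet n d :=
  Quotient.mk (vertSetoid n d) ⟨incl c p.1, ⟨c.υ, by simp [incl]⟩,
    fun h => by simpa [incl] using congrFun h c.α, p.2⟩

/-- The defining equations only depend on the classes of the homogeneous data. -/
theorem eqn_eq_zero_of_homogRel {n d : ℕ} {w w' : Homog n d} (h : HomogRel w w')
    (hw : ∀ k, eqn k w = 0) (k : Fin (n + 1)) : eqn k w' = 0 := by
  obtain ⟨⟨g, -, hg⟩, s, -, hs⟩ := h
  let I : Ideal ℂ⟦X⟧ := Ideal.span {PowerSeries.X ^ (n + 1)}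
  have key : ∀ f : ℂ⟦X⟧, Ideal.Quotient.mk I f = 0 ↔
      ∀ k : Fin (n + 1), PowerSeries.coeff (k : ℕ) f = 0 := fun f => by
    rw [Ideal.Quotient.eq_zero_iff_mem, Ideal.mem_span_singleton, PowerSeries.X_pow_dvd_iff]
    exact ⟨fun h k => h k k.2, fun h m hm => h ⟨m, hm⟩⟩
  have hser : ∀ i, Ideal.Quotient.mk I (ser (w'.1 i)) =
      Ideal.Quotient.mk I g * Ideal.Quotient.mk I (ser (w.1 i)) := fun i => by
    rw [← map_mul, ← sub_eq_zero, ← map_sub, key]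
    intro k
    rw [map_sub, coeff_ser, hg, sub_self]
  have h0 := (key _).2 hw
  refine (key _).1 ?_ k
  simp only [map_sum, map_mul, map_prod, map_pow] at h0 ⊢
  have hterm : ∀ β : MonIdx n d, Ideal.Quotient.mk I (PowerSeries.C (w'.2 β)) *
        ∏ i, Ideal.Quotient.mk I (ser (w'.1 i)) ^ β.1 i =
      (Ideal.Quotient.mk I (PowerSeries.C s) * Ideal.Quotient.mk I g ^ d) *
        (Ideal.Quotient.mk I (PowerSeries.C (w.2 β)) *
          ∏ i, Ideal.Quotient.mk I (ser (w.1 i)) ^ β.1 i) := fun β => by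
    simp only [hser, mul_pow, Finset.prod_mul_distrib, Finset.prod_pow_eq_pow_sum, β.2, hs,
      Pi.smul_apply, smul_eq_mul, map_mul]
    ring
  rw [Finset.sum_congr rfl fun β _ => hterm β, ← Finset.mul_sum, h0, mul_zero]

theorem homogRel_incl_coord {n d : ℕ} (c : Chart n d) (w : Homog n d) (hZ : w.1 c.υ 0 ≠ 0)
    (hA : w.2 c.α ≠ 0) : HomogRel w (incl c (coord c w)) := by
  have h0 : PowerSeries.constantCoeff (ser (w.1 c.υ)) ≠ 0 := by
    simpa [ser] using hZ
  refine ⟨⟨(ser (w.1 c.υ))⁻¹, by simpa using h0, fun i k => ?_⟩, (w.2 c.α)⁻¹, inv_ne_zero hA, ?_⟩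
  · by_cases h : i = c.υ
    · subst h
      rw [PowerSeries.inv_mul_cancel _ h0]
      rw [PowerSeries.coeff_one]
      by_cases hk : k = 0
      · simp [incl, hk]
      · have hk' : (k : ℕ) ≠ 0 := fun h => hk (Fin.ext h)
        simp [incl, hk]
    · simp [incl, coord, h, mul_comm]
  · funext β
    by_cases h : β = c.α
    · subst h
      simp [incl, hA]
    · simp [incl, coord, h, div_eq_inv_mul]

/-- The standard charts cover `J^n_vert(𝒳)`. -/
theorem exists_chartPoint {n d : ℕ} (x : VertJet n d) :
    ∃ (c : Chart n d) (p : chartLocus c), chartPoint c p = x := by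
  induction x using Quotient.inductionOn with
  | h w =>
    obtain ⟨w, ⟨υ, hZ⟩, hA, hw⟩ := w
    obtain ⟨α, hα⟩ := Function.ne_iff.1 hA
    have hrel := homogRel_incl_coord ⟨υ, α⟩ w hZ hα
    exact ⟨⟨υ, α⟩, ⟨coord ⟨υ, α⟩ w, eqn_eq_zero_of_homogRel hrel hw⟩,
      Quotient.sound ((homogRel_equivalence n d).symm hrel)⟩

/-- The base chart `{Z_0 ≠ 0} × {A_{0 d 0 … 0} ≠ 0}`. -/
def baseChart (n d : ℕ) : Chart n d := ⟨0, ⟨Pi.single 1 d, by simp⟩⟩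

/-- All first order jet coordinates vanish. -/
def FirstOrderVanish {n d : ℕ} {c : Chart n d} (p : ChartSpace c) : Prop :=
  ∀ i : {i : Fin (n + 2) // i ≠ c.υ}, p (Sum.inl (i, 1)) = 0

/-- The bad set: the closure in `J^n_vert(𝒳)` of the set of vertical jets in the base chart all of
whose first order jet coordinates vanish. -/
def badSet (n d : ℕ) : Set (VertJet n d) :=
  closure {x | ∃ p : chartLocus (baseChart n d), FirstOrderVanish p.1 ∧
    chartPoint (baseChart n d) p = x}

/-- The tangent space of `J^n_vert(𝒳)` at a point, in a chart: the common kernel of the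
differentials of the defining equations. -/
def tangentSpace {n d : ℕ} (c : Chart n d) (p : ChartSpace c) : Submodule ℂ (ChartSpace c) :=
  ⨅ k : Fin (n + 1), (fderiv ℂ (fun q : ChartSpace c => eqn k (incl c q)) p).ker

/-- A subset `S` of a complex normed space is, near `p`, a complex submanifold of dimension `m` and
codimension `k`: some biholomorphic map from a neighborhood of `p` to an open subset of `ℂ^m × ℂ^k`
maps `S` to `ℂ^m × {0}`. -/
def IsComplexSubmanifoldAt {E : Type*} [NormedAddCommGroup E] [NormedSpace ℂ E]
    (S : Set E) (p : E) (m k : ℕ) : Prop :=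
  ∃ e : OpenPartialHomeomorph E ((Fin m → ℂ) × (Fin k → ℂ)),
    p ∈ e.source ∧ DifferentiableOn ℂ e e.source ∧ DifferentiableOn ℂ e.symm e.target ∧
      ∀ q ∈ e.source, (q ∈ S ↔ (e q).2 = 0)

/-- A global section, over the whole of `J^n_vert(𝒳)`, of
`T_{J^n_vert(𝒳)} ⊗ 𝒪_{ℙ^{n+1}}(a) ⊗ 𝒪_{ℙ^N}(b)`, given by its expressions in the standard charts,
where `𝒪(a)` and `𝒪(b)` are trivialized by `Z_υ^a` and `A_α^b`. -/
structure TwistedField (n d a b : ℕ) where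
  /-- the expression in a chart -/
  val : ∀ c : Chart n d, chartLocus c → ChartSpace c
  /-- the components are regular functions on the affine algebraic set `chartLocus c` -/
  regular : ∀ (c : Chart n d) (j : CoordIdx c), ∃ P : MvPolynomial (CoordIdx c) ℂ,
    ∀ p : chartLocus c, val c p j = MvPolynomial.eval p.1 P
  /-- tangency -/
  tangent : ∀ (c : Chart n d) (p : chartLocus c), val c p ∈ tangentSpace c p.1
  /-- the transformation rule: the differential of the change of coordinates, times the transition
  functions `(Z_υ / Z_υ')^a` and `(A_α / A_α')^b` of the two line bundles -/
  compat : ∀ (c c' : Chart n d) (p : chartLocus c) (q : chartLocus c'),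
    chartPoint c p = chartPoint c' q →
      val c' q = ((((incl c p.1).1 c'.υ 0) ^ a)⁻¹ * (((incl c p.1).2 c'.α) ^ b)⁻¹) •
        fderiv ℂ (trans c c') p.1 (val c p)

end VertJets

end

open VertJets

open scoped PowerSeries

noncomputable section

namespace VertJets

open MvPolynomial Topology Filter

variable {n d : ℕ}

/-! Work in the local ring `R = ℂ[ζ]/(ζ^{n+1})`. A vertical jet is a pair `(Z, A)` with `Z ∈
R^{n+2}` and `F_A(Z) = 0` in `R`, taken up to multiplication of `Z` by a unit `g` of `R` and of `A`
by a nonzero constant `s`. Everything rests on one fact (`JetRing.eq_zero_of_sum_smul_pow_eq_zero`):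
if `z ∈ R` has nonzero first order coefficient, then `1, z, …, z^n` are linearly independent, hence
a basis of `R`. Outside the bad set, after normalizing `Z_u = 1`, some `Z_v` has this property, so
the jets `Z_u^{n-j} Z_v^j`, `0 ≤ j ≤ n`, form a basis.

Smoothness: since `d ≥ n`, varying the coefficients `A` alone already makes the differential of
`F_A(Z)` surjective onto `R` (`linForm_varIncl_surjective`); the inverse function theorem and a
dimension count do the rest.

Global sections: a polynomial vector field on the data `(Z, A)` that is tangent to the equation and
equivariant under `(g, s)` with weights `(a, b)` descends to a section of the twisted bundle
(`HomogField.toTwistedField`). Such fields come from expanding a jet in `Z_u^{n-j} Z_v^j` by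
Cramer's rule. The determinant scales by `g(0)^{n(n+1)}`, which fits into the weight `n^2 + 2n`; the
missing powers are supplied by some `Z_m(0)`. Three families are used: `pairRel` and `linePow` move
`A` by forms vanishing along the jet, and `shift` moves one coordinate `Z_i` and compensates by a
change of `A`.

Spanning: modulo the first two families every form of degree `d` reduces to a combination of
`X_u^{d-j} X_v^j` with `j ≤ n`. If the form vanishes along the jet, so does the combination, which
is then zero by the basic fact. The third family produces arbitrary variations of `Z`, and
subtracting them from a tangent vector leaves a form vanishing along the jet
(`mem_valueSpan_of_linForm_eq_zero`).

The bad set is the locus where `Z(0)` and `Z'(0)` are proportional. This condition is closed and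
independent of the representative; conversely, any such jet is carried into the base chart by
projective transformations arbitrarily close to the identity (`mk_mem_badSet_iff`). -/

/-- The ring `ℂ[ζ] / (ζ^{n+1})` of `n`-jets of functions of one variable. -/
def JetRing (n : ℕ) : Type := ℂ⟦X⟧ ⧸ Ideal.span {(PowerSeries.X : ℂ⟦X⟧) ^ (n + 1)}

/-! ### Truncated jets: coefficients, units, multiplication matrices, norm -/

namespace JetRing

instance : CommRing (JetRing n) :=
  inferInstanceAs (CommRing (ℂ⟦X⟧ ⧸ Ideal.span {(PowerSeries.X : ℂ⟦X⟧) ^ (n + 1)}))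

instance : Algebra ℂ (JetRing n) :=
  inferInstanceAs (Algebra ℂ (ℂ⟦X⟧ ⧸ Ideal.span {(PowerSeries.X : ℂ⟦X⟧) ^ (n + 1)}))

/-- The jet of a power series. -/
def mk : ℂ⟦X⟧ →ₐ[ℂ] JetRing n :=
  Ideal.Quotient.mkₐ ℂ (Ideal.span {(PowerSeries.X : ℂ⟦X⟧) ^ (n + 1)})

theorem mk_surjective : Function.Surjective (mk : ℂ⟦X⟧ →ₐ[ℂ] JetRing n) :=
  Ideal.Quotient.mkₐ_surjective _ _

theorem mk_eq_zero_iff_dvd (f : ℂ⟦X⟧) : (mk f : JetRing n) = 0 ↔ PowerSeries.X ^ (n + 1) ∣ f := by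
  rw [← Ideal.mem_span_singleton]
  exact Ideal.Quotient.eq_zero_iff_mem

theorem mk_eq_zero_iff (f : ℂ⟦X⟧) :
    (mk f : JetRing n) = 0 ↔ ∀ k : Fin (n + 1), PowerSeries.coeff (k : ℕ) f = 0 := by
  rw [mk_eq_zero_iff_dvd, PowerSeries.X_pow_dvd_iff]
  exact ⟨fun h k => h k k.2, fun h m hm => h ⟨m, hm⟩⟩

theorem mk_eq_mk_iff (f g : ℂ⟦X⟧) : (mk f : JetRing n) = mk g ↔
    ∀ k : Fin (n + 1), PowerSeries.coeff (k : ℕ) f = PowerSeries.coeff (k : ℕ) g := by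
  rw [← sub_eq_zero, ← map_sub, mk_eq_zero_iff]
  simp only [map_sub, sub_eq_zero]

/-- Jets correspond to their coefficients of order `0, …, n`. -/
def ofCoeff (n : ℕ) : (Fin (n + 1) → ℂ) ≃ₗ[ℂ] JetRing n :=
  LinearEquiv.ofBijective
    { toFun := fun f => mk (ser f)
      map_add' := fun f g => by
        rw [← map_add, mk_eq_mk_iff]; intro k; simp [coeff_ser]
      map_smul' := fun s f => by
        rw [RingHom.id_apply, ← map_smul, mk_eq_mk_iff]; intro k; simp [coeff_ser] }
    ⟨fun f g h => by
        have h' := (mk_eq_mk_iff _ _).1 h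
        funext k
        simpa [coeff_ser] using h' k,
      fun x => by
        obtain ⟨f, rfl⟩ := mk_surjective x
        refine ⟨fun k => PowerSeries.coeff (k : ℕ) f, ?_⟩
        refine (mk_eq_mk_iff _ _).2 fun k => ?_
        rw [coeff_ser]⟩

theorem ofCoeff_apply (f : Fin (n + 1) → ℂ) : ofCoeff n f = mk (ser f) := rfl

/-- The coefficient of order `k` of a jet. -/
def coeff (k : Fin (n + 1)) : JetRing n →ₗ[ℂ] ℂ :=
  LinearMap.proj k ∘ₗ (ofCoeff n).symm.toLinearMap

theorem coeff_ofCoeff (f : Fin (n + 1) → ℂ) (k : Fin (n + 1)) : coeff k (ofCoeff n f) = f k := by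
  simp [coeff]

theorem coeff_mk (f : ℂ⟦X⟧) (k : Fin (n + 1)) :
    coeff k (mk f) = PowerSeries.coeff (k : ℕ) f := by
  have : (mk f : JetRing n) = ofCoeff n fun k => PowerSeries.coeff (k : ℕ) f := by
    rw [ofCoeff_apply, mk_eq_mk_iff]
    intro k
    rw [coeff_ser]
  rw [this, coeff_ofCoeff]

@[ext]
theorem ext {x y : JetRing n} (h : ∀ k, coeff k x = coeff k y) : x = y :=
  (ofCoeff n).symm.injective (funext h)

theorem ofCoeff_coeff (x : JetRing n) : (ofCoeff n fun k => coeff k x) = x := by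
  ext k; rw [coeff_ofCoeff]

theorem coeff_zero_mul (x y : JetRing n) : coeff 0 (x * y) = coeff 0 x * coeff 0 y := by
  obtain ⟨f, rfl⟩ := mk_surjective x
  obtain ⟨g, rfl⟩ := mk_surjective y
  rw [← map_mul, coeff_mk, coeff_mk, coeff_mk]
  simp

theorem coeff_one (k : Fin (n + 1)) : coeff k (1 : JetRing n) = if k = 0 then 1 else 0 := by
  rw [← map_one mk, coeff_mk, PowerSeries.coeff_one]
  simp only [Fin.ext_iff, Fin.val_zero]

theorem coeff_zero_pow (x : JetRing n) (m : ℕ) : coeff 0 (x ^ m) = coeff 0 x ^ m := by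
  induction m with
  | zero => rw [pow_zero, pow_zero, coeff_one, if_pos rfl]
  | succ m ih => rw [pow_succ, coeff_zero_mul, ih, pow_succ]

theorem isUnit_iff {x : JetRing n} : IsUnit x ↔ coeff 0 x ≠ 0 := by
  constructor
  · rintro ⟨u, rfl⟩ h
    have := coeff_zero_mul (u : JetRing n) ↑u⁻¹
    rw [u.mul_inv, h, zero_mul, coeff_one, if_pos rfl] at this
    exact one_ne_zero this
  · intro h
    obtain ⟨f, rfl⟩ := mk_surjective x
    rw [coeff_mk] at h
    exact IsUnit.map mk (PowerSeries.isUnit_iff_constantCoeff.2 (by simpa using h))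

/-- The parameter, raised to the power `k`. -/
def param (n k : ℕ) : JetRing n := mk (PowerSeries.X ^ k)

theorem coeff_param (a b : Fin (n + 1)) : coeff a (param n b) = if a = b then 1 else 0 := by
  rw [param, coeff_mk, PowerSeries.coeff_X_pow]
  simp [Fin.ext_iff]

theorem eq_sum_param (x : JetRing n) : x = ∑ k : Fin (n + 1), coeff k x • param n k := by
  ext a
  simp [coeff_param]

theorem coeff_mul_param (x : JetRing n) (a b : Fin (n + 1)) :
    coeff a (x * param n b) =
      if h : b ≤ a then coeff ⟨a - b, by omega⟩ x else 0 := by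
  obtain ⟨f, rfl⟩ := mk_surjective x
  rw [param, ← map_mul, coeff_mk, PowerSeries.coeff_mul_X_pow']
  simp [coeff_mk]

/-- Written with constant structure coefficients, the product is visibly polynomial in the
coefficients of the factors. -/
theorem coeff_mul (x y : JetRing n) (k : Fin (n + 1)) :
    coeff k (x * y) =
      ∑ a, ∑ b, coeff a x * coeff b y * coeff k (param n a * param n b) := by
  conv_lhs => rw [eq_sum_param x, eq_sum_param y, Finset.sum_mul_sum, map_sum]
  refine Finset.sum_congr rfl fun a _ => ?_
  rw [map_sum]
  refine Finset.sum_congr rfl fun b _ => ?_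
  rw [smul_mul_smul_comm, map_smul, smul_eq_mul]

/-- The matrix of multiplication by a jet. -/
def mulMatrix (x : JetRing n) : Matrix (Fin (n + 1)) (Fin (n + 1)) ℂ :=
  Matrix.of fun a b => coeff a (x * param n b)

theorem mulMatrix_mulVec (x y : JetRing n) :
    (mulMatrix x).mulVec (fun b => coeff b y) = fun a => coeff a (x * y) := by
  funext a
  conv_rhs => rw [eq_sum_param y, Finset.mul_sum]
  simp [Matrix.mulVec, dotProduct, mulMatrix, mul_comm]

/-- In the basis of powers of the parameter, multiplication by `x` is lower triangular with `x(0)`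
on the diagonal. -/
theorem det_mulMatrix (x : JetRing n) : (mulMatrix x).det = coeff 0 x ^ (n + 1) := by
  rw [Matrix.det_of_isLowerTriangular]
  · simp [mulMatrix, coeff_mul_param]
  · intro a b hab
    have hab' : a < b := by simpa using hab
    simp [mulMatrix, coeff_mul_param, hab'.not_ge]

/-- The basis of powers of the parameter. -/
def basis (n : ℕ) : Module.Basis (Fin (n + 1)) ℂ (JetRing n) := .ofEquivFun (ofCoeff n).symm

instance : Module.Finite ℂ (JetRing n) := Module.Finite.of_basis (basis n)

attribute [local instance] Matrix.linftyOpNormedRing Matrix.linftyOpNormedAlgebra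

/-- The operator norm pulled back through the regular representation is submultiplicative, so
inversion can be differentiated as in any complete normed algebra. -/
instance : NormedCommRing (JetRing n) :=
  NormedCommRing.induced _ _ (Algebra.leftMulMatrix (basis n))
    (Algebra.leftMulMatrix_injective (basis n))

instance : NormedAlgebra ℂ (JetRing n) :=
  NormedAlgebra.induced ℂ (JetRing n) (Matrix (Fin (n + 1)) (Fin (n + 1)) ℂ)
    (Algebra.leftMulMatrix (basis n))

instance : CompleteSpace (JetRing n) := FiniteDimensional.complete ℂ _

/-- The coefficients as continuous linear maps. -/
def coeffL (k : Fin (n + 1)) : JetRing n →L[ℂ] ℂ := LinearMap.toContinuousLinearMap (coeff k)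

@[simp] theorem coeffL_apply (k : Fin (n + 1)) (x : JetRing n) : coeffL k x = coeff k x := rfl

end JetRing

/-! ### Forms of degree `d`, their values along jets, and the linearized equation -/

/-- The exponent of a monomial of degree `d`. -/
def MonIdx.exponent (β : MonIdx n d) : Fin (n + 2) →₀ ℕ := Finsupp.equivFunOnFinite.symm β.1

@[simp] theorem MonIdx.exponent_apply (β : MonIdx n d) (i : Fin (n + 2)) :
    β.exponent i = β.1 i := rfl

theorem MonIdx.exponent_injective :
    Function.Injective (MonIdx.exponent : MonIdx n d → Fin (n + 2) →₀ ℕ) :=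
  Finsupp.equivFunOnFinite.symm.injective.comp Subtype.val_injective

theorem MonIdx.degree_exponent (β : MonIdx n d) : β.exponent.degree = d := by
  rw [Finsupp.degree_eq_sum]
  exact β.2

/-- The index of a monomial of degree `d`. -/
def MonIdx.ofExponent (m : Fin (n + 2) →₀ ℕ) (h : m.degree = d) : MonIdx n d :=
  ⟨m, by rw [← h, Finsupp.degree_eq_sum]⟩

theorem MonIdx.exponent_ofExponent (m : Fin (n + 2) →₀ ℕ) (h : m.degree = d) :
    (MonIdx.ofExponent m h).exponent = m := by
  ext i; rfl

/-- The form of degree `d` with given coefficients. -/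
def form : (MonIdx n d → ℂ) →ₗ[ℂ] MvPolynomial (Fin (n + 2)) ℂ :=
  ∑ β : MonIdx n d, (monomial β.exponent) ∘ₗ LinearMap.proj β

theorem form_apply (A : MonIdx n d → ℂ) : form A = ∑ β, monomial β.exponent (A β) := by
  simp [form]

/-- The coefficients in degree `d` of a polynomial. -/
def formCoeff (n d : ℕ) : MvPolynomial (Fin (n + 2)) ℂ →ₗ[ℂ] (MonIdx n d → ℂ) :=
  LinearMap.pi fun β => lcoeff ℂ β.exponent

@[simp] theorem formCoeff_apply (P : MvPolynomial (Fin (n + 2)) ℂ) (β : MonIdx n d) :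
    formCoeff n d P β = P.coeff β.exponent := rfl

theorem formCoeff_form (A : MonIdx n d → ℂ) : formCoeff n d (form A) = A := by
  funext β
  rw [formCoeff_apply, form_apply, coeff_sum, Finset.sum_eq_single β]
  · simp
  · intro γ _ h
    rw [coeff_monomial, if_neg fun h' => h (MonIdx.exponent_injective h')]
  · simp

theorem form_isHomogeneous (A : MonIdx n d → ℂ) : (form A).IsHomogeneous d := by
  rw [form_apply]
  exact IsHomogeneous.sum _ _ _ fun β _ => isHomogeneous_monomial _ β.degree_exponent

theorem form_formCoeff {P : MvPolynomial (Fin (n + 2)) ℂ} (hP : P.IsHomogeneous d) :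
    form (formCoeff n d P) = P := by
  ext m
  by_cases h : m.degree = d
  · have := congrFun (formCoeff_form (formCoeff n d P)) (MonIdx.ofExponent m h)
    rwa [formCoeff_apply, formCoeff_apply, MonIdx.exponent_ofExponent] at this
  · rw [hP.coeff_eq_zero h, (form_isHomogeneous _).coeff_eq_zero h]

theorem form_injective : Function.Injective (form : (MonIdx n d → ℂ) →ₗ[ℂ] _) :=
  Function.LeftInverse.injective formCoeff_form

/-- Homogeneous data whose first component is a tuple of elements of the ring of jets. -/
abbrev JetData (n d : ℕ) : Type := (Fin (n + 2) → JetRing n) × (MonIdx n d → ℂ)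

/-- Homogeneous data, read in the ring of jets. -/
def jets : Homog n d ≃ₗ[ℂ] JetData n d :=
  (LinearEquiv.piCongrRight fun _ => JetRing.ofCoeff n).prodCongr (.refl ℂ _)

theorem jets_fst (w : Homog n d) (i : Fin (n + 2)) : (jets w).1 i = JetRing.ofCoeff n (w.1 i) := rfl

@[simp] theorem jets_snd (w : Homog n d) : (jets w).2 = w.2 := rfl

theorem coeff_jets (w : Homog n d) (i : Fin (n + 2)) (k : Fin (n + 1)) :
    JetRing.coeff k ((jets w).1 i) = w.1 i k := by
  rw [jets_fst, JetRing.coeff_ofCoeff]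

/-- The jet of `∑_β A_β Z^β`. -/
def evalForm (w : JetData n d) : JetRing n := aeval w.1 (form w.2)

theorem evalForm_eq_sum (w : JetData n d) :
    evalForm w = ∑ β : MonIdx n d, w.2 β • ∏ i, w.1 i ^ β.1 i := by
  rw [evalForm, form_apply, map_sum]
  refine Finset.sum_congr rfl fun β _ => ?_
  rw [aeval_monomial, Algebra.smul_def, Finsupp.prod_fintype _ _ (by simp)]
  rfl

theorem eqn_eq (k : Fin (n + 1)) (w : Homog n d) :
    eqn k w = JetRing.coeff k (evalForm (jets w)) := by
  rw [eqn, ← JetRing.coeff_mk, evalForm_eq_sum, map_sum]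
  congr 1
  refine Finset.sum_congr rfl fun β _ => ?_
  rw [map_mul, map_prod, Algebra.smul_def]
  simp only [map_pow]
  rfl

theorem eqn_eq_zero_iff (w : Homog n d) : (∀ k, eqn k w = 0) ↔ evalForm (jets w) = 0 := by
  simp only [eqn_eq]
  exact ⟨fun h => JetRing.ext fun k => by rw [h, map_zero], fun h k => by rw [h, map_zero]⟩

/-- The linearization of `evalForm`. -/
def linForm (w : JetData n d) : JetData n d →ₗ[ℂ] JetRing n :=
  (aeval w.1).toLinearMap ∘ₗ form ∘ₗ LinearMap.snd ℂ _ _ +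
    ∑ i, LinearMap.mulLeft ℂ (aeval w.1 (pderiv i (form w.2))) ∘ₗ LinearMap.proj i ∘ₗ
      LinearMap.fst ℂ _ _

theorem linForm_apply (w v : JetData n d) : linForm w v =
    aeval w.1 (form v.2) + ∑ i, aeval w.1 (pderiv i (form w.2)) * v.1 i := by
  simp [linForm]

theorem hasFDerivAt_aeval (P : MvPolynomial (Fin (n + 2)) ℂ) (Z : Fin (n + 2) → JetRing n) :
    HasFDerivAt (fun Z : Fin (n + 2) → JetRing n => aeval Z P)
      (∑ i, aeval Z (pderiv i P) • ContinuousLinearMap.proj (R := ℂ) (φ := fun _ : Fin (n + 2) => JetRing n) i) Z := by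
  induction P using MvPolynomial.induction_on with
  | C a => 
    simp only [algHom_C, pderiv_C, map_zero]
    refine (hasFDerivAt_const (𝕜 := ℂ) (algebraMap ℂ (JetRing n) a) Z).congr_fderiv ?_
    ext1 v
    simp [_root_.sum_apply]
  | add p q hp hq => 
    simp only [map_add]
    refine (hp.fun_add hq).congr_fderiv ?_
    ext1 v
    simp [_root_.sum_apply, add_mul, Finset.sum_add_distrib]
  | mul_X p i hp =>
    have h1 : HasFDerivAt (fun Z : Fin (n + 2) → JetRing n => Z i)
      (ContinuousLinearMap.proj (R := ℂ) (φ := fun _ : Fin (n + 2) => JetRing n) i) Z := hasFDerivAt_apply i Z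
    have h2 := hp.fun_mul h1
    simp only [map_mul, aeval_X]
    refine h2.congr_fderiv ?_
    ext1 v
    simp only [pderiv_mul, pderiv_X, map_add, map_mul, aeval_X, _root_.add_apply,
      _root_.smul_apply, _root_.sum_apply,
      ContinuousLinearMap.proj_apply, smul_eq_mul, add_mul, Finset.sum_add_distrib,
      Finset.mul_sum]
    rw [add_comm]
    congr 1
    · exact Finset.sum_congr rfl fun j _ => by ring
    · rw [Finset.sum_eq_single i]
      · simp
      · intro j _ hj
        simp [Ne.symm hj]
      · simp

theorem contDiff_aeval (P : MvPolynomial (Fin (n + 2)) ℂ) :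
    ContDiff ℂ 1 fun Z : Fin (n + 2) → JetRing n => aeval Z P := by
  induction P using MvPolynomial.induction_on with
  | C a => simpa using contDiff_const
  | add p q hp hq => simpa using hp.add hq
  | mul_X p i hp => simpa using hp.mul (contDiff_apply ℂ _ i)

theorem evalForm_eq_sum_aeval (w : JetData n d) :
    evalForm w = ∑ β : MonIdx n d, w.2 β • aeval w.1 (monomial β.exponent (1 : ℂ)) := by
  rw [evalForm, form_apply, map_sum]
  refine Finset.sum_congr rfl fun β _ => ?_
  rw [← map_smul, smul_monomial, smul_eq_mul, mul_one]

theorem contDiff_evalForm : ContDiff ℂ 1 (evalForm : JetData n d → JetRing n) := by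
  have : (evalForm : JetData n d → JetRing n) = fun w => ∑ β : MonIdx n d,
      w.2 β • aeval w.1 (monomial β.exponent (1 : ℂ)) := funext evalForm_eq_sum_aeval
  rw [this]
  refine ContDiff.sum fun β _ => ContDiff.fun_smul ?_ ((contDiff_aeval _).comp contDiff_fst)
  exact (contDiff_apply ℂ ℂ β).comp contDiff_snd

theorem hasFDerivAt_evalForm (w : JetData n d) :
    HasFDerivAt evalForm (LinearMap.toContinuousLinearMap (linForm w)) w := by
  have h1 : (evalForm : JetData n d → JetRing n) = fun w => ∑ β : MonIdx n d,
      w.2 β • aeval w.1 (monomial β.exponent (1 : ℂ)) := funext evalForm_eq_sum_aeval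
  have h0 : ∀ β : MonIdx n d, HasFDerivAt (fun w : JetData n d => w.2 β)
      (ContinuousLinearMap.proj (R := ℂ) (φ := fun _ : MonIdx n d => ℂ) β ∘L
        ContinuousLinearMap.snd ℂ (Fin (n + 2) → JetRing n) (MonIdx n d → ℂ)) w := fun β =>
    ContinuousLinearMap.hasFDerivAt (ContinuousLinearMap.proj (R := ℂ)
      (φ := fun _ : MonIdx n d => ℂ) β ∘L
        ContinuousLinearMap.snd ℂ (Fin (n + 2) → JetRing n) (MonIdx n d → ℂ))
  have h2 : ∀ β : MonIdx n d, HasFDerivAt (fun w : JetData n d =>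
      w.2 β • (aeval w.1 (monomial β.exponent (1 : ℂ)) : JetRing n)) _ w := fun β =>
    HasFDerivAt.fun_smul (h0 β)
      ((hasFDerivAt_aeval (monomial β.exponent (1 : ℂ)) w.1).comp w hasFDerivAt_fst)
  rw [h1]
  refine (HasFDerivAt.fun_sum fun β _ => h2 β).congr_fderiv ?_
  refine ContinuousLinearMap.ext fun v => ?_
  rw [LinearMap.coe_toContinuousLinearMap', linForm_apply, form_apply, form_apply]
  simp only [_root_.sum_apply, _root_.add_apply,
    Finset.sum_add_distrib, map_sum]
  rw [add_comm]
  congr 1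
  · refine Finset.sum_congr rfl fun β _ => ?_
    simp only [ContinuousLinearMap.smulRight_apply, ContinuousLinearMap.comp_apply,
      ContinuousLinearMap.proj_apply, ContinuousLinearMap.coe_snd']
    rw [← map_smul, smul_monomial, smul_eq_mul, mul_one]
  · simp only [_root_.smul_apply, ContinuousLinearMap.comp_apply,
      _root_.sum_apply, Finset.smul_sum, Finset.sum_mul,
      ContinuousLinearMap.proj_apply, ContinuousLinearMap.coe_fst', smul_eq_mul]
    rw [Finset.sum_comm]
    refine Finset.sum_congr rfl fun i _ => Finset.sum_congr rfl fun β _ => ?_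
    rw [← smul_mul_assoc, ← map_smul, ← Derivation.map_smul, smul_monomial, smul_eq_mul, mul_one]

/-! ### Charts as normalized homogeneous data -/

/-- Tangent directions of a chart, as variations of the normalized homogeneous data. -/
def varIncl (c : Chart n d) : ChartSpace c →ₗ[ℂ] JetData n d where
  toFun v := (fun i => if h : i = c.υ then 0 else
      JetRing.ofCoeff n fun k => v (Sum.inl (⟨i, h⟩, k)),
    fun β => if h : β = c.α then 0 else v (Sum.inr ⟨β, h⟩))
  map_add' v w := by
    ext1
    · funext i
      by_cases h : i = c.υ
      · simp [h]
      · simp only [h, Pi.add_apply, dite_false, Prod.fst_add, ← map_add]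
        rfl
    · funext β
      by_cases h : β = c.α <;> simp [h]
  map_smul' s v := by
    ext1
    · funext i
      by_cases h : i = c.υ
      · simp [h]
      · simp only [h, Pi.smul_apply, dite_false, Prod.smul_fst, ← map_smul, RingHom.id_apply]
        rfl
    · funext β
      by_cases h : β = c.α <;> simp [h]

/-- The normalized homogeneous data of a chart point. -/
def inclJets (c : Chart n d) (p : ChartSpace c) : JetData n d := jets (incl c p)

theorem inclJets_eq (c : Chart n d) (p : ChartSpace c) :
    inclJets c p = (Pi.single c.υ 1, Pi.single c.α 1) + varIncl c p := by
  ext1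
  · funext i
    ext k
    rw [inclJets, coeff_jets]
    by_cases h : i = c.υ
    · subst h
      simp [incl, varIncl, JetRing.coeff_one]
    · simp [incl, varIncl, JetRing.coeff_ofCoeff, h]
  · funext β
    by_cases h : β = c.α
    · subst h
      simp [inclJets, incl, varIncl]
    · simp [inclJets, incl, varIncl, h]

theorem inclJets_υ (c : Chart n d) (p : ChartSpace c) : (inclJets c p).1 c.υ = 1 := by
  rw [inclJets_eq]
  simp [varIncl]

theorem inclJets_α (c : Chart n d) (p : ChartSpace c) : (inclJets c p).2 c.α = 1 := by
  rw [inclJets_eq]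
  simp [varIncl]

theorem hasFDerivAt_inclJets (c : Chart n d) (p : ChartSpace c) :
    HasFDerivAt (inclJets c) (LinearMap.toContinuousLinearMap (varIncl c)) p := by
  have : inclJets c = fun p => ((Pi.single c.υ 1, Pi.single c.α 1) : JetData n d) +
      LinearMap.toContinuousLinearMap (varIncl c) p := funext (inclJets_eq c)
  rw [this]
  exact (ContinuousLinearMap.hasFDerivAt _).const_add _

theorem contDiff_inclJets (c : Chart n d) : ContDiff ℂ 1 (inclJets c) := by
  have : inclJets c = fun p => ((Pi.single c.υ 1, Pi.single c.α 1) : JetData n d) +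
      LinearMap.toContinuousLinearMap (varIncl c) p := funext (inclJets_eq c)
  rw [this]
  exact contDiff_const.add (ContinuousLinearMap.contDiff _)

theorem mem_chartLocus {c : Chart n d} {p : ChartSpace c} :
    p ∈ chartLocus c ↔ evalForm (inclJets c p) = 0 := eqn_eq_zero_iff _

/-- The defining equations of a chart, as a map. -/
def chartEqn (c : Chart n d) (p : ChartSpace c) : Fin (n + 1) → ℂ := fun k => eqn k (incl c p)

theorem hasFDerivAt_chartEqn_apply (c : Chart n d) (p : ChartSpace c) (k : Fin (n + 1)) :
    HasFDerivAt (fun q => eqn k (incl c q)) (JetRing.coeffL k ∘L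
      LinearMap.toContinuousLinearMap (linForm (inclJets c p) ∘ₗ varIncl c)) p := by
  have h := (JetRing.coeffL k).hasFDerivAt.comp p
    ((hasFDerivAt_evalForm (inclJets c p)).comp p (hasFDerivAt_inclJets c p))
  have e : (fun q => eqn k (incl c q)) =
      JetRing.coeffL k ∘ evalForm ∘ inclJets c := funext fun q => eqn_eq _ _
  rw [e]
  exact h

theorem contDiff_chartEqn (c : Chart n d) : ContDiff ℂ 1 (chartEqn c) := by
  refine contDiff_pi.2 fun k => ?_
  have e : (fun q => eqn k (incl c q)) =
      JetRing.coeffL k ∘ evalForm ∘ inclJets c := funext fun q => eqn_eq _ _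
  change ContDiff ℂ 1 fun q => eqn k (incl c q)
  rw [e]
  exact (JetRing.coeffL k).contDiff.comp (contDiff_evalForm.comp (contDiff_inclJets c))

theorem mem_tangentSpace {c : Chart n d} {p v : ChartSpace c} :
    v ∈ tangentSpace c p ↔ linForm (inclJets c p) (varIncl c v) = 0 := by
  simp only [tangentSpace, Submodule.mem_iInf, LinearMap.mem_ker,
    (hasFDerivAt_chartEqn_apply c p _).fderiv]
  exact ⟨fun h => JetRing.ext fun k => by simpa using h k, fun h k => by simp [h]⟩

/-! ### Powers of an immersed jet and Cramer's rule -/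

/-- A relation is a polynomial `q` of degree at most `n` with `q(f)` divisible by `X^{n+1}`. Since
`f - f(0)` has order exactly one, the order of `q(f)` is the multiplicity of `f(0)` as a root of
`q`, which cannot exceed the degree of a nonzero `q`. -/
theorem JetRing.eq_zero_of_sum_smul_pow_eq_zero (hn : 1 ≤ n) (z : JetRing n)
    (hz : JetRing.coeff 1 z ≠ 0) (x : Fin (n + 1) → ℂ)
    (hx : ∑ j : Fin (n + 1), x j • z ^ (j : ℕ) = 0) : x = 0 := by
  obtain ⟨f, rfl⟩ := JetRing.mk_surjective z
  have hone : ((1 : Fin (n + 1)) : ℕ) = 1 := by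
    rw [Fin.val_one', Nat.mod_eq_of_lt (by omega)]
  rw [JetRing.coeff_mk, hone] at hz
  set q : Polynomial ℂ := ∑ j : Fin (n + 1), Polynomial.monomial (j : ℕ) (x j) with hq
  have hqc : ∀ j : Fin (n + 1), q.coeff j = x j := fun j => by
    rw [hq, Polynomial.finsetSum_coeff, Finset.sum_eq_single j]
    · simp
    · intro k _ hk
      rw [Polynomial.coeff_monomial, if_neg fun h => hk (Fin.ext h)]
    · simp
  have hdeg : q.natDegree ≤ n := by
    refine Polynomial.natDegree_sum_le_of_forall_le _ _ fun j _ => ?_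
    exact (Polynomial.natDegree_monomial_le _).trans (Nat.lt_succ_iff.1 j.2)
  have hdvd : PowerSeries.X ^ (n + 1) ∣ Polynomial.aeval f q := by
    rw [← JetRing.mk_eq_zero_iff_dvd, ← hx, hq]
    simp only [map_sum, Polynomial.aeval_monomial, ← Algebra.smul_def, map_smul, map_pow]
  by_contra hne
  have hq0 : q ≠ 0 := by
    intro h
    refine hne (funext fun j => ?_)
    rw [← hqc j, h]
    simp
  set t := PowerSeries.constantCoeff f with ht
  obtain ⟨r, hr, hrt⟩ := Polynomial.exists_eq_pow_rootMultiplicity_mul_and_not_dvd q hq0 t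
  set m := q.rootMultiplicity t
  rw [Polynomial.dvd_iff_isRoot, Polynomial.IsRoot.def] at hrt
  obtain ⟨u, hu⟩ : PowerSeries.X ∣ f - PowerSeries.C t := by
    rw [PowerSeries.X_dvd_iff]
    simp [ht]
  have hu1 : IsUnit u := by
    have h1 := congrArg (PowerSeries.coeff 1) hu
    rw [map_sub, PowerSeries.coeff_C, if_neg one_ne_zero, sub_zero] at h1
    rw [PowerSeries.isUnit_iff_constantCoeff, isUnit_iff_ne_zero,
      ← PowerSeries.coeff_zero_eq_constantCoeff_apply]
    rwa [h1, show (1 : ℕ) = 0 + 1 from rfl, PowerSeries.coeff_succ_X_mul] at hz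
  have hr1 : IsUnit (Polynomial.aeval f r) := by
    rw [PowerSeries.isUnit_iff_constantCoeff, isUnit_iff_ne_zero, Polynomial.aeval_def,
      Polynomial.hom_eval₂, ← ht]
    exact hrt
  -- Both `u` and `r(f)` are units, because `f` has nonzero first order coefficient and `r` does not
  -- vanish at `t = f(0)`.
  have hfac : Polynomial.aeval f q =
      PowerSeries.X ^ m * (u ^ m * Polynomial.aeval f r) := by
    rw [hr, map_mul, map_pow, map_sub, Polynomial.aeval_X, Polynomial.aeval_C,
      show algebraMap ℂ ℂ⟦X⟧ t = PowerSeries.C t from rfl, hu, mul_pow, mul_assoc]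
  rw [hfac, ((hu1.pow m).mul hr1).dvd_mul_right,
    pow_dvd_pow_iff PowerSeries.X_ne_zero PowerSeries.X_prime.not_isUnit] at hdvd
  have hm : m ≤ q.natDegree := by
    exact (Polynomial.count_roots q (a := t) ▸ Multiset.count_le_card t q.roots).trans
      (Polynomial.card_roots' q)
  omega

/-- The matrix of coefficients of the jets `Z_u^{n-j} Z_v^j`, `0 ≤ j ≤ n`. -/
def pairMatrix (u v : Fin (n + 2)) (Z : Fin (n + 2) → JetRing n) :
    Matrix (Fin (n + 1)) (Fin (n + 1)) ℂ :=
  Matrix.of fun a j => JetRing.coeff a (Z u ^ (n - j : ℕ) * Z v ^ (j : ℕ))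

/-- The determinant of the jets `Z_u^{n-j} Z_v^j`, `0 ≤ j ≤ n`. -/
def pairDet (u v : Fin (n + 2)) (Z : Fin (n + 2) → JetRing n) : ℂ := (pairMatrix u v Z).det

/-- The coefficients, given by Cramer's rule, of `pairDet u v Z • r` as a combination of the jets
`Z_u^{n-j} Z_v^j`. -/
def pairSolve (u v : Fin (n + 2)) (Z : Fin (n + 2) → JetRing n) (r : JetRing n) :
    Fin (n + 1) → ℂ :=
  (pairMatrix u v Z).cramer fun a => JetRing.coeff a r

theorem coeff_sum_pair (u v : Fin (n + 2)) (Z : Fin (n + 2) → JetRing n) (x : Fin (n + 1) → ℂ) :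
    (fun a => JetRing.coeff a (∑ j : Fin (n + 1), x j • (Z u ^ (n - j : ℕ) * Z v ^ (j : ℕ)))) =
      (pairMatrix u v Z).mulVec x := by
  funext a
  simp [Matrix.mulVec, dotProduct, pairMatrix, mul_comm]

theorem sum_pairSolve (u v : Fin (n + 2)) (Z : Fin (n + 2) → JetRing n) (r : JetRing n) :
    ∑ j : Fin (n + 1), pairSolve u v Z r j • (Z u ^ (n - j : ℕ) * Z v ^ (j : ℕ)) =
      pairDet u v Z • r := by
  ext a
  have := congrFun (coeff_sum_pair u v Z (pairSolve u v Z r)) a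
  rw [this, pairSolve, Matrix.mulVec_cramer]
  simp [pairDet]

/-- Each column is the coefficient vector of a monomial of degree `n` in `Z`, so rescaling by `g`
multiplies all the columns by the same jet `g ^ n`. -/
theorem pairMatrix_smul (u v : Fin (n + 2)) (Z : Fin (n + 2) → JetRing n) (g : JetRing n) :
    pairMatrix u v (g • Z) = JetRing.mulMatrix (g ^ n) * pairMatrix u v Z := by
  ext a j
  have := congrFun (JetRing.mulMatrix_mulVec (g ^ n) (Z u ^ (n - j : ℕ) * Z v ^ (j : ℕ))) a
  rw [Matrix.mul_apply_eq_vecMul]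
  refine Eq.trans ?_ this.symm
  have hj : n = (n - j : ℕ) + j := by have := j.2; omega
  simp only [pairMatrix, Matrix.of_apply, Pi.smul_apply, smul_eq_mul, mul_pow]
  congr 1
  conv_rhs => rw [show g ^ n = g ^ (n - j : ℕ) * g ^ (j : ℕ) by rw [← pow_add, ← hj]]
  ring

theorem det_mulMatrix_pow (g : JetRing n) :
    (JetRing.mulMatrix (g ^ n)).det = JetRing.coeff 0 g ^ (n * (n + 1)) := by
  rw [JetRing.det_mulMatrix, JetRing.coeff_zero_pow, ← pow_mul]

theorem pairDet_smul (u v : Fin (n + 2)) (Z : Fin (n + 2) → JetRing n) (g : JetRing n) :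
    pairDet u v (g • Z) = JetRing.coeff 0 g ^ (n * (n + 1)) * pairDet u v Z := by
  rw [pairDet, pairMatrix_smul, Matrix.det_mul, det_mulMatrix_pow, pairDet]

/-- Cramer's solution is the adjugate applied to the right-hand side. The adjugate reverses
products, and the factor coming from `g ^ n` cancels up to its determinant; this needs no
invertibility of `g`. -/
theorem pairSolve_smul (u v : Fin (n + 2)) (Z : Fin (n + 2) → JetRing n) (g r : JetRing n) :
    pairSolve u v (g • Z) (g ^ n * r) =
      JetRing.coeff 0 g ^ (n * (n + 1)) • pairSolve u v Z r := by
  rw [pairSolve, pairMatrix_smul, ← JetRing.mulMatrix_mulVec, Matrix.cramer_eq_adjugate_mulVec,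
    Matrix.adjugate_mul_distrib, Matrix.mulVec_mulVec, Matrix.mul_assoc, Matrix.adjugate_mul,
    det_mulMatrix_pow, pairSolve, Matrix.cramer_eq_adjugate_mulVec]
  simp [Matrix.smul_mulVec]

/-- A kernel vector would be a linear relation among `1, Z_v, …, Z_v^n`. -/
theorem pairDet_ne_zero (hn : 1 ≤ n) {u v : Fin (n + 2)} {Z : Fin (n + 2) → JetRing n}
    (hu : Z u = 1) (hv : JetRing.coeff 1 (Z v) ≠ 0) : pairDet u v Z ≠ 0 := by
  intro h
  obtain ⟨x, hx0, hx⟩ := Matrix.exists_mulVec_eq_zero_iff.2 h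
  rw [← coeff_sum_pair] at hx
  refine hx0 (JetRing.eq_zero_of_sum_smul_pow_eq_zero hn _ hv x (JetRing.ext fun k => ?_))
  simpa [hu] using congrFun hx k

/-- The form `X^μ ∑_j c_j X_u^{n-j} X_v^j`, where the `c_j` are given by `pairSolve`. -/
def pairForm (u v : Fin (n + 2)) (Z : Fin (n + 2) → JetRing n) (μ : Fin (n + 2) →₀ ℕ)
    (r : JetRing n) : MvPolynomial (Fin (n + 2)) ℂ :=
  ∑ j : Fin (n + 1), pairSolve u v Z r j • (monomial μ 1 * (X u ^ (n - j : ℕ) * X v ^ (j : ℕ)))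

theorem aeval_pairForm (u v : Fin (n + 2)) (Z : Fin (n + 2) → JetRing n) (μ : Fin (n + 2) →₀ ℕ)
    (r : JetRing n) : aeval Z (pairForm u v Z μ r) =
      pairDet u v Z • (aeval Z (monomial μ (1 : ℂ)) * r) := by
  rw [mul_comm, ← smul_mul_assoc, ← sum_pairSolve, pairForm, map_sum, Finset.sum_mul]
  refine Finset.sum_congr rfl fun j _ => ?_
  rw [map_smul, map_mul, map_mul, map_pow, map_pow, aeval_X, aeval_X, smul_mul_assoc, mul_comm]

theorem isHomogeneous_pair (u v : Fin (n + 2)) (j : Fin (n + 1)) :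
    (X u ^ (n - j : ℕ) * X v ^ (j : ℕ) : MvPolynomial (Fin (n + 2)) ℂ).IsHomogeneous n := by
  have := (isHomogeneous_X_pow (R := ℂ) u (n - j : ℕ)).mul (isHomogeneous_X_pow v (j : ℕ))
  rwa [Nat.sub_add_cancel (Nat.lt_succ_iff.1 j.2)] at this

theorem pairForm_isHomogeneous (u v : Fin (n + 2)) (Z : Fin (n + 2) → JetRing n)
    {μ : Fin (n + 2) →₀ ℕ} (hμ : μ.degree + n = d) (r : JetRing n) :
    (pairForm u v Z μ r).IsHomogeneous d := by
  refine IsHomogeneous.sum _ _ _ fun j _ => ?_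
  rw [smul_eq_C_mul, ← hμ]
  exact IsHomogeneous.C_mul ((isHomogeneous_monomial _ rfl).mul (isHomogeneous_pair u v j)) _

theorem pairForm_smul (u v : Fin (n + 2)) (Z : Fin (n + 2) → JetRing n) (μ : Fin (n + 2) →₀ ℕ)
    (g r : JetRing n) : pairForm u v (g • Z) μ (g ^ n * r) =
      JetRing.coeff 0 g ^ (n * (n + 1)) • pairForm u v Z μ r := by
  simp only [pairForm, pairSolve_smul, Finset.smul_sum, Pi.smul_apply, smul_eq_mul, mul_smul]

/-! ### Surjectivity of the differential and smoothness -/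

theorem exists_aeval_form_eq (hn : 1 ≤ n) (hd : n ≤ d) {u v : Fin (n + 2)}
    {Z : Fin (n + 2) → JetRing n} (hu : Z u = 1) (hv : JetRing.coeff 1 (Z v) ≠ 0)
    (r : JetRing n) : ∃ A : MonIdx n d → ℂ, aeval Z (form A) = r := by
  have h0 := pairDet_ne_zero hn hu hv
  have hdeg : (Finsupp.single u (d - n)).degree + n = d := by
    rw [Finsupp.degree_single, Nat.sub_add_cancel hd]
  refine ⟨formCoeff n d ((pairDet u v Z)⁻¹ •
    pairForm u v Z (Finsupp.single u (d - n)) r), ?_⟩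
  rw [map_smul, map_smul, form_formCoeff (pairForm_isHomogeneous u v Z hdeg r), map_smul,
    aeval_pairForm, aeval_monomial, Finsupp.prod_single_index (h := fun i k => Z i ^ k) (pow_zero _), hu, one_pow, map_one, one_mul, one_mul,
    smul_smul, inv_mul_cancel₀ h0, one_smul]

/-- Variations of the coefficients suffice; the jet can be kept fixed. -/
theorem linForm_varIncl_surjective (hn : 1 ≤ n) (hd : n ≤ d) {c : Chart n d} {p : ChartSpace c}
    (hp : p ∈ chartLocus c) {v : Fin (n + 2)} (hv : JetRing.coeff 1 ((inclJets c p).1 v) ≠ 0) :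
    Function.Surjective (linForm (inclJets c p) ∘ₗ varIncl c) := by
  intro r
  obtain ⟨A, hA⟩ := exists_aeval_form_eq (d := d) hn hd (inclJets_υ c p) hv r
  -- The chart fixes `A_α = 1`, so the variation must vanish at `α`. Subtracting a multiple of the
  -- form itself achieves this without changing the value, since the form vanishes along the jet.
  set B : MonIdx n d → ℂ := A - A c.α • (inclJets c p).2 with hB
  have hBα : B c.α = 0 := by simp [hB, inclJets_α]
  refine ⟨Sum.elim 0 fun β => B β.1, ?_⟩
  have hvar : varIncl c (Sum.elim 0 fun β => B β.1) = (0, B) := by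
    ext1
    · funext i
      by_cases h : i = c.υ
      · simp [varIncl, h]
      · simp only [varIncl, LinearMap.coe_mk, AddHom.coe_mk, h, dite_false, Sum.elim_inl,
          Pi.zero_apply]
        exact map_zero (JetRing.ofCoeff n)
    · funext β
      by_cases h : β = c.α
      · subst h; simp [varIncl, hBα]
      · simp [varIncl, h]
  rw [LinearMap.comp_apply, hvar, linForm_apply]
  have h0 := mem_chartLocus.1 hp
  rw [evalForm] at h0
  simp [hB, hA, h0]

theorem card_monIdx (n d : ℕ) : Fintype.card (MonIdx n d) = (n + 1 + d).choose (n + 1) := by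
  have h1 : Fintype.card (MonIdx n d) =
      (Finset.piAntidiag (Finset.univ : Finset (Fin (n + 2))) d).card :=
    Fintype.card_of_subtype _ (by simp [Finset.mem_piAntidiag])
  rw [h1, ← Finset.map_sym_eq_piAntidiag, Finset.card_map, Finset.sym_univ, Finset.card_univ,
    Sym.card_sym_eq_choose, Fintype.card_fin, show n + 2 + d - 1 = n + 1 + d by omega,
    Nat.choose_symm_add]

theorem card_coordIdx (c : Chart n d) :
    Fintype.card (CoordIdx c) = paramDim n d + n * (n + 1) + (n + 1) := by
  rw [Fintype.card_sum, Fintype.card_prod, Fintype.card_subtype_compl, Fintype.card_subtype_compl,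
    Fintype.card_subtype_eq, Fintype.card_subtype_eq, card_monIdx, Fintype.card_fin,
    Fintype.card_fin, paramDim]
  simp only [show n + 2 - 1 = n + 1 from rfl]
  ring

/-- Complete `f` by a linear projection onto the kernel of its differential at `p`; the resulting
map has invertible differential there, and the inverse function theorem straightens the zero set. -/
theorem isComplexSubmanifoldAt_of_surjective {E : Type*} [NormedAddCommGroup E] [NormedSpace ℂ E]
    [FiniteDimensional ℂ E] {m k : ℕ} (hE : Module.finrank ℂ E = m + k) {f : E → Fin k → ℂ}
    (hf : ContDiff ℂ 1 f) {p : E} (hp : Function.Surjective (fderiv ℂ f p)) :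
    IsComplexSubmanifoldAt {q | f q = 0} p m k := by
  have : CompleteSpace E := FiniteDimensional.complete ℂ E
  set f' : E →L[ℂ] Fin k → ℂ := fderiv ℂ f p with hf'
  obtain ⟨C, hC⟩ := Submodule.exists_isCompl (LinearMap.ker (f' : E →ₗ[ℂ] Fin k → ℂ))
  have hker : Module.finrank ℂ (LinearMap.ker (f' : E →ₗ[ℂ] Fin k → ℂ)) = m := by
    have h1 := LinearMap.finrank_range_add_finrank_ker (f' : E →ₗ[ℂ] Fin k → ℂ)
    rw [LinearMap.range_eq_top.2 hp, finrank_top, Module.finrank_fin_fun, hE] at h1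
    omega
  let φ : LinearMap.ker (f' : E →ₗ[ℂ] Fin k → ℂ) ≃ₗ[ℂ] (Fin m → ℂ) :=
    LinearEquiv.ofFinrankEq _ _ (by rw [hker, Module.finrank_fin_fun])
  let P : E →L[ℂ] (Fin m → ℂ) :=
    LinearMap.toContinuousLinearMap (φ.toLinearMap ∘ₗ Submodule.projectionOnto _ C hC)
  let g : E → (Fin m → ℂ) × (Fin k → ℂ) := fun q => (P q, f q)
  have hg : ContDiff ℂ 1 g := P.contDiff.prodMk hf
  have hinj : Function.Injective (P.prod f') := by
    rw [injective_iff_map_eq_zero]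
    intro x hx
    have h1 : f' x = 0 := congrArg Prod.snd hx
    have h2 : P x = 0 := congrArg Prod.fst hx
    have h3 := Submodule.projectionOnto_apply_left hC ⟨x, h1⟩
    have h4 : Submodule.projectionOnto _ C hC x = 0 := φ.injective (by simpa [P] using h2)
    have h5 := h3.symm.trans h4
    exact congrArg Subtype.val h5
  have hdim : Module.finrank ℂ E = Module.finrank ℂ ((Fin m → ℂ) × (Fin k → ℂ)) := by
    rw [Module.finrank_prod, Module.finrank_fin_fun, Module.finrank_fin_fun, hE]
  let L : E ≃L[ℂ] (Fin m → ℂ) × (Fin k → ℂ) :=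
    (LinearEquiv.ofInjectiveOfFinrankEq (P.prod f').toLinearMap hinj hdim).toContinuousLinearEquiv
  have hL : (L : E →L[ℂ] (Fin m → ℂ) × (Fin k → ℂ)) = P.prod f' := by
    ext1 x; rfl
  have hfd : ∀ q, HasFDerivAt g (P.prod (fderiv ℂ f q)) q := fun q =>
    P.hasFDerivAt.prodMk ((hf.differentiable one_ne_zero) q).hasFDerivAt
  have hgp : HasFDerivAt g (L : E →L[ℂ] (Fin m → ℂ) × (Fin k → ℂ)) p := hL ▸ hfd p
  let e := hg.contDiffAt.toOpenPartialHomeomorph g hgp one_ne_zero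
  have hcont : Continuous fun q => P.prod (fderiv ℂ f q) := by
    have h1 : (fun q => P.prod (fderiv ℂ f q)) = fderiv ℂ g := funext fun q => (hfd q).fderiv.symm
    rw [h1]
    exact hg.continuous_fderiv one_ne_zero
  -- The inverse must be differentiable on the whole target, so the chart is restricted to the open
  -- set where the differential stays invertible.
  let U : Set E := {q | P.prod (fderiv ℂ f q) ∈
    Set.range ((↑) : (E ≃L[ℂ] (Fin m → ℂ) × (Fin k → ℂ)) → _)}
  have hU : IsOpen U := (ContinuousLinearEquiv.isOpen (𝕜 := ℂ)).preimage hcont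
  have hpU : p ∈ U := ⟨L, hL⟩
  have hpe : p ∈ e.source := hg.contDiffAt.mem_toOpenPartialHomeomorph_source hgp one_ne_zero
  refine ⟨e.restrOpen U hU, ⟨hpe, hpU⟩, ?_, ?_, fun q _ => Iff.rfl⟩
  · exact (hg.differentiable one_ne_zero).differentiableOn
  · intro y hy
    have hy' : y ∈ e.target ∧ e.symm y ∈ U := by
      have h1 := (e.restrOpen U hU).map_target hy
      rw [OpenPartialHomeomorph.restrOpen_source] at h1
      exact ⟨hy.1, h1.2⟩
    obtain ⟨M, hM⟩ := hy'.2
    exact (e.hasFDerivAt_symm hy'.1 (f' := M)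
      (by rw [hM]; exact hfd _)).differentiableAt.differentiableWithinAt

theorem chartLocus_eq (c : Chart n d) : chartLocus c = {q | chartEqn c q = 0} := by
  ext q
  exact funext_iff.symm

theorem hasFDerivAt_chartEqn (c : Chart n d) (p : ChartSpace c) :
    HasFDerivAt (chartEqn c) (ContinuousLinearMap.pi fun k => JetRing.coeffL k ∘L
      LinearMap.toContinuousLinearMap (linForm (inclJets c p) ∘ₗ varIncl c)) p :=
  hasFDerivAt_pi.2 fun k => hasFDerivAt_chartEqn_apply c p k

theorem isComplexSubmanifoldAt_chartLocus {c : Chart n d} {p : ChartSpace c}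
    (h : Function.Surjective (linForm (inclJets c p) ∘ₗ varIncl c)) :
    IsComplexSubmanifoldAt (chartLocus c) p (paramDim n d + n * (n + 1)) (n + 1) := by
  rw [chartLocus_eq]
  refine isComplexSubmanifoldAt_of_surjective ?_ (contDiff_chartEqn c) ?_
  · rw [Module.finrank_fintype_fun_eq_card, card_coordIdx]
  · rw [(hasFDerivAt_chartEqn c p).fderiv]
    intro y
    obtain ⟨v, hv⟩ := h (JetRing.ofCoeff n y)
    refine ⟨v, funext fun k => ?_⟩
    rw [← JetRing.coeff_ofCoeff y k, ← hv]
    rfl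

theorem tangentSpace_eq_ker (c : Chart n d) (p : ChartSpace c) :
    tangentSpace c p = LinearMap.ker (linForm (inclJets c p) ∘ₗ varIncl c) := by
  ext v
  exact mem_tangentSpace

theorem finrank_jetRing : Module.finrank ℂ (JetRing n) = n + 1 := by
  rw [Module.finrank_eq_card_basis (JetRing.basis n), Fintype.card_fin]

theorem finrank_tangentSpace {c : Chart n d} {p : ChartSpace c}
    (h : Function.Surjective (linForm (inclJets c p) ∘ₗ varIncl c)) :
    Module.finrank ℂ (tangentSpace c p) = paramDim n d + n * (n + 1) := by
  have h1 := LinearMap.finrank_range_add_finrank_ker (linForm (inclJets c p) ∘ₗ varIncl c)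
  rw [LinearMap.range_eq_top.2 h, finrank_top, finrank_jetRing,
    Module.finrank_fintype_fun_eq_card, card_coordIdx] at h1
  rw [tangentSpace_eq_ker]
  omega

/-! ### Polynomial dependence on coordinates -/

section Polynomial

variable {σ : Type}

/-- The algebra of polynomial functions. -/
def polyFun (σ : Type) : Subalgebra ℂ ((σ → ℂ) → ℂ) :=
  (aeval fun (i : σ) (p : σ → ℂ) => p i : MvPolynomial σ ℂ →ₐ[ℂ] (σ → ℂ) → ℂ).range

theorem mem_polyFun_iff {f : (σ → ℂ) → ℂ} :
    f ∈ polyFun σ ↔ ∃ P : MvPolynomial σ ℂ, ∀ p, f p = eval p P := by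
  have key : ∀ (P : MvPolynomial σ ℂ) (p : σ → ℂ),
      (aeval fun (i : σ) (q : σ → ℂ) => q i : MvPolynomial σ ℂ →ₐ[ℂ] (σ → ℂ) → ℂ) P p =
        eval p P := fun P p => by
    have : (Pi.evalAlgHom ℂ (fun _ : σ → ℂ => ℂ) p).comp
        (aeval fun (i : σ) (p : σ → ℂ) => p i) = aeval p := by
      ext i; simp
    exact DFunLike.congr_fun this P
  constructor
  · rintro ⟨P, rfl⟩
    exact ⟨P, fun p => key P p⟩
  · rintro ⟨P, hP⟩
    exact ⟨P, funext fun p => (key P p).trans (hP p).symm⟩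

theorem coord_mem_polyFun (i : σ) : (fun p : σ → ℂ => p i) ∈ polyFun σ :=
  mem_polyFun_iff.2 ⟨X i, fun _ => (eval_X i).symm⟩

theorem const_mem_polyFun (s : ℂ) : (fun _ : σ → ℂ => s) ∈ polyFun σ :=
  (polyFun σ).algebraMap_mem s

theorem mul_mem_polyFun {f g : (σ → ℂ) → ℂ} (hf : f ∈ polyFun σ) (hg : g ∈ polyFun σ) :
    (fun p => f p * g p) ∈ polyFun σ := (polyFun σ).mul_mem hf hg

theorem pow_mem_polyFun {f : (σ → ℂ) → ℂ} (hf : f ∈ polyFun σ) (m : ℕ) :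
    (fun p => f p ^ m) ∈ polyFun σ := (polyFun σ).pow_mem hf m

theorem sub_mem_polyFun {f g : (σ → ℂ) → ℂ} (hf : f ∈ polyFun σ) (hg : g ∈ polyFun σ) :
    (fun p => f p - g p) ∈ polyFun σ := (polyFun σ).sub_mem hf hg

theorem neg_mem_polyFun {f : (σ → ℂ) → ℂ} (hf : f ∈ polyFun σ) :
    (fun p => -f p) ∈ polyFun σ := (polyFun σ).neg_mem hf

theorem sum_mem_polyFun {ι : Type*} (s : Finset ι) {f : ι → (σ → ℂ) → ℂ}
    (hf : ∀ i ∈ s, f i ∈ polyFun σ) : (fun p => ∑ i ∈ s, f i p) ∈ polyFun σ := by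
  have := (polyFun σ).sum_mem hf
  convert this using 1
  funext p
  simp

theorem prod_mem_polyFun {ι : Type*} (s : Finset ι) {f : ι → (σ → ℂ) → ℂ}
    (hf : ∀ i ∈ s, f i ∈ polyFun σ) : (fun p => ∏ i ∈ s, f i p) ∈ polyFun σ := by
  have := (polyFun σ).prod_mem hf
  convert this using 1
  funext p
  simp

theorem det_mem_polyFun {m : ℕ} {M : (σ → ℂ) → Matrix (Fin m) (Fin m) ℂ}
    (hM : ∀ a b, (fun p => M p a b) ∈ polyFun σ) : (fun p => (M p).det) ∈ polyFun σ := by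
  simp only [Matrix.det_apply']
  exact sum_mem_polyFun _ fun π _ =>
    mul_mem_polyFun (const_mem_polyFun _) (prod_mem_polyFun _ fun i _ => hM _ _)

theorem cramer_mem_polyFun {m : ℕ} {M : (σ → ℂ) → Matrix (Fin m) (Fin m) ℂ}
    {x : (σ → ℂ) → Fin m → ℂ} (hM : ∀ a b, (fun p => M p a b) ∈ polyFun σ)
    (hx : ∀ a, (fun p => x p a) ∈ polyFun σ) (j : Fin m) :
    (fun p => (M p).cramer (x p) j) ∈ polyFun σ := by
  simp only [Matrix.cramer_apply]
  refine det_mem_polyFun fun a b => ?_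
  by_cases h : b = j
  · subst h; simpa using hx a
  · simpa [Matrix.updateCol_ne h] using hM a b

/-- Polynomial functions with values in the ring of jets. -/
def IsPolyJet (f : (σ → ℂ) → JetRing n) : Prop := ∀ k, (fun p => JetRing.coeff k (f p)) ∈ polyFun σ

theorem IsPolyJet.const (x : JetRing n) : IsPolyJet fun _ : σ → ℂ => x :=
  fun _ => const_mem_polyFun _

theorem IsPolyJet.sub {f g : (σ → ℂ) → JetRing n} (hf : IsPolyJet f) (hg : IsPolyJet g) :
    IsPolyJet fun p => f p - g p := fun k => by
  simpa only [map_sub] using sub_mem_polyFun (hf k) (hg k)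

theorem IsPolyJet.smul {s : (σ → ℂ) → ℂ} {f : (σ → ℂ) → JetRing n} (hs : s ∈ polyFun σ)
    (hf : IsPolyJet f) : IsPolyJet fun p => s p • f p := fun k => by
  simpa only [map_smul, smul_eq_mul] using mul_mem_polyFun hs (hf k)

theorem IsPolyJet.mul {f g : (σ → ℂ) → JetRing n} (hf : IsPolyJet f) (hg : IsPolyJet g) :
    IsPolyJet fun p => f p * g p := fun k => by
  rw [show (fun p => JetRing.coeff k (f p * g p)) = fun p => ∑ a, ∑ b, JetRing.coeff a (f p) *
    JetRing.coeff b (g p) * JetRing.coeff k (JetRing.param n a * JetRing.param n b) from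
    funext fun p => JetRing.coeff_mul _ _ _]
  exact sum_mem_polyFun _ fun a _ => sum_mem_polyFun _ fun b _ =>
    mul_mem_polyFun (mul_mem_polyFun (hf a) (hg b)) (const_mem_polyFun _)

theorem IsPolyJet.pow {f : (σ → ℂ) → JetRing n} (hf : IsPolyJet f) (m : ℕ) :
    IsPolyJet fun p => f p ^ m := by
  induction m with
  | zero => simpa only [pow_zero] using IsPolyJet.const 1
  | succ m ih => simpa only [pow_succ] using ih.mul hf

theorem IsPolyJet.aeval_monomial {Z : (σ → ℂ) → Fin (n + 2) → JetRing n}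
    (hZ : ∀ i, IsPolyJet fun p => Z p i) (m : Fin (n + 2) →₀ ℕ) :
    IsPolyJet fun p => aeval (Z p) (monomial m (1 : ℂ)) := by
  induction m using Finsupp.induction_linear with
  | zero => simpa using IsPolyJet.const 1
  | add f g hf hg =>
    have : ∀ p, aeval (Z p) (monomial (f + g) (1 : ℂ)) =
        aeval (Z p) (monomial f (1 : ℂ)) * aeval (Z p) (monomial g (1 : ℂ)) := fun p => by
      rw [← map_mul, monomial_mul, one_mul]
    simpa only [this] using hf.mul hg
  | single i m =>
    have : ∀ p, aeval (Z p) (monomial (Finsupp.single i m) (1 : ℂ)) = Z p i ^ m := fun p => by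
      rw [← X_pow_eq_monomial, map_pow, aeval_X]
    simpa only [this] using (hZ i).pow m

/-- Functions whose values are polynomials with polynomial coefficients. -/
def IsPolyForm (P : (σ → ℂ) → MvPolynomial (Fin (n + 2)) ℂ) : Prop :=
  ∀ m, (fun p => (P p).coeff m) ∈ polyFun σ

theorem IsPolyForm.const (P : MvPolynomial (Fin (n + 2)) ℂ) : IsPolyForm fun _ : σ → ℂ => P :=
  fun _ => const_mem_polyFun _

theorem IsPolyForm.sub {P Q : (σ → ℂ) → MvPolynomial (Fin (n + 2)) ℂ} (hP : IsPolyForm P)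
    (hQ : IsPolyForm Q) : IsPolyForm fun p => P p - Q p := fun m => by
  simpa only [coeff_sub] using sub_mem_polyFun (hP m) (hQ m)

theorem IsPolyForm.sum {ι : Type*} (s : Finset ι)
    {P : ι → (σ → ℂ) → MvPolynomial (Fin (n + 2)) ℂ} (hP : ∀ i ∈ s, IsPolyForm (P i)) :
    IsPolyForm fun p => ∑ i ∈ s, P i p := fun m => by
  simpa only [coeff_sum] using sum_mem_polyFun s fun i hi => hP i hi m

theorem IsPolyForm.smul {s : (σ → ℂ) → ℂ} {P : (σ → ℂ) → MvPolynomial (Fin (n + 2)) ℂ}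
    (hs : s ∈ polyFun σ) (hP : IsPolyForm P) : IsPolyForm fun p => s p • P p := fun m => by
  simpa only [coeff_smul, smul_eq_mul] using mul_mem_polyFun hs (hP m)

theorem IsPolyForm.mul {P Q : (σ → ℂ) → MvPolynomial (Fin (n + 2)) ℂ} (hP : IsPolyForm P)
    (hQ : IsPolyForm Q) : IsPolyForm fun p => P p * Q p := fun m => by
  simpa only [coeff_mul] using sum_mem_polyFun _ fun x _ => mul_mem_polyFun (hP x.1) (hQ x.2)

theorem IsPolyForm.pow {P : (σ → ℂ) → MvPolynomial (Fin (n + 2)) ℂ} (hP : IsPolyForm P) (m : ℕ) :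
    IsPolyForm fun p => P p ^ m := by
  induction m with
  | zero => simpa only [pow_zero] using IsPolyForm.const 1
  | succ m ih => simpa only [pow_succ] using ih.mul hP

/-- Polynomial functions with values in the homogeneous data. -/
def IsPolyData (w : (σ → ℂ) → JetData n d) : Prop :=
  (∀ i, IsPolyJet fun p => (w p).1 i) ∧ ∀ β, (fun p => (w p).2 β) ∈ polyFun σ

theorem isPolyData_inclJets (c : Chart n d) : IsPolyData (inclJets c) := by
  refine ⟨fun i k => ?_, fun β => ?_⟩
  · simp only [inclJets, coeff_jets, incl]
    split_ifs
    exacts [const_mem_polyFun _, const_mem_polyFun _, coord_mem_polyFun _]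
  · simp only [inclJets, jets_snd, incl]
    split_ifs
    exacts [const_mem_polyFun _, coord_mem_polyFun _]

end Polynomial

/-! ### From homogeneous variations to chart directions and changes of chart -/

/-- The tangent direction, in a chart, of a variation of homogeneous data that are normalized in
that chart. -/
def chartDir (c : Chart n d) (w : JetData n d) (v : JetData n d) : ChartSpace c :=
  Sum.elim (fun q => JetRing.coeff q.2 (v.1 q.1.1 - w.1 q.1.1 * v.1 c.υ))
    fun β => v.2 β.1 - w.2 β.1 * v.2 c.α

/-- `chartDir` as a linear map. -/
def chartDirₗ (c : Chart n d) (w : JetData n d) : JetData n d →ₗ[ℂ] ChartSpace c where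
  toFun := chartDir c w
  map_add' u v := by
    funext j
    rcases j with q | β
    · simp only [chartDir, Sum.elim_inl, Pi.add_apply, Prod.fst_add, ← map_add]
      congr 1; ring
    · simp only [chartDir, Sum.elim_inr, Pi.add_apply, Prod.snd_add]
      ring
  map_smul' s v := by
    funext j
    rcases j with q | β
    · simp only [chartDir, Sum.elim_inl, Pi.smul_apply, Prod.smul_fst, RingHom.id_apply,
        ← map_smul, mul_smul_comm, smul_sub]
    · simp only [chartDir, Sum.elim_inr, Pi.smul_apply, Prod.smul_snd, RingHom.id_apply,
        smul_eq_mul]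
      ring

theorem chartDir_varIncl (c : Chart n d) (w : JetData n d) (v : ChartSpace c) :
    chartDir c w (varIncl c v) = v := by
  funext j
  rcases j with ⟨⟨i, hi⟩, k⟩ | ⟨β, hβ⟩
  · simp [chartDir, varIncl, hi, JetRing.coeff_ofCoeff]
  · simp [chartDir, varIncl, hβ]

/-- The correction is the infinitesimal rescaling of `Z` and of `A` that restores the normalization
of the chart. -/
theorem varIncl_chartDir {c : Chart n d} {w : JetData n d} (hw : w.1 c.υ = 1) (hw' : w.2 c.α = 1)
    (v : JetData n d) :
    varIncl c (chartDir c w v) = v - (v.1 c.υ • w.1, v.2 c.α • w.2) := by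
  ext1
  · funext i
    by_cases h : i = c.υ
    · subst h; simp [varIncl, hw]
    · simp only [varIncl, chartDir, LinearMap.coe_mk, AddHom.coe_mk, h, dite_false, Sum.elim_inl,
        JetRing.ofCoeff_coeff, Prod.fst_sub, Pi.sub_apply, Pi.smul_apply, smul_eq_mul, mul_comm]
  · funext β
    by_cases h : β = c.α
    · subst h; simp [varIncl, hw']
    · simp [varIncl, chartDir, h, mul_comm]

/-- Euler's identity, with `Z` rescaled by a jet and `A` by a constant: such directions are
annihilated by the linearized equation wherever the equation holds. -/
theorem linForm_euler (w : JetData n d) (h : JetRing n) (s : ℂ) :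
    linForm w (h • w.1, s • w.2) = (d • h + algebraMap ℂ (JetRing n) s) * evalForm w := by
  have h1 := congrArg (aeval w.1) (form_isHomogeneous w.2).sum_X_mul_pderiv
  rw [map_sum, map_nsmul] at h1
  simp only [map_mul, aeval_X] at h1
  have h2 : ∑ i, aeval w.1 (pderiv i (form w.2)) * (h * w.1 i) = h * (d • evalForm w) := by
    rw [evalForm, ← h1, Finset.mul_sum]
    exact Finset.sum_congr rfl fun i _ => by ring
  have h3 : aeval w.1 (form (s • w.2)) = algebraMap ℂ (JetRing n) s * evalForm w := by
    rw [map_smul, map_smul, evalForm, Algebra.smul_def]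
  rw [linForm_apply, h3]
  simp only [Pi.smul_apply, smul_eq_mul]
  rw [h2, nsmul_eq_mul, nsmul_eq_mul]
  ring

theorem chartDir_mem_tangentSpace {c : Chart n d} {p : ChartSpace c} (hp : p ∈ chartLocus c)
    {v : JetData n d} (hv : linForm (inclJets c p) v = 0) :
    chartDir c (inclJets c p) v ∈ tangentSpace c p := by
  rw [mem_tangentSpace, varIncl_chartDir (inclJets_υ c p) (inclJets_α c p), map_sub, hv,
    linForm_euler, mem_chartLocus.1 hp, mul_zero, sub_zero]

/-- The quotient rule in a commutative Banach algebra, with `b` the inverse of the denominator. -/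
theorem hasFDerivAt_mul_ringInverse {E R : Type*} [NormedAddCommGroup E] [NormedSpace ℂ E]
    [NormedCommRing R] [NormedAlgebra ℂ R] [CompleteSpace R] {f g : E → R} {f' g' : E →L[ℂ] R}
    {p : E} (hf : HasFDerivAt f f' p) (hg : HasFDerivAt g g' p) {b : R} (hb : g p * b = 1) :
    ∃ L : E →L[ℂ] R, HasFDerivAt (fun q => f q * Ring.inverse (g q)) L p ∧
      ∀ v, L v = b * f' v - f p * b * (b * g' v) := by
  let u : Rˣ := ⟨g p, b, hb, by rw [mul_comm, hb]⟩
  have h1 : HasFDerivAt (fun q => Ring.inverse (g q)) _ p :=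
    (hasFDerivAt_ringInverse (𝕜 := ℂ) u).comp p hg
  refine ⟨_, hf.fun_mul h1, fun v => ?_⟩
  have h2 : Ring.inverse (g p) = b := Ring.inverse_unit u
  have h3 : ((u⁻¹ : Rˣ) : R) = b := rfl
  simp [h2, h3]
  ring

/-- No hypothesis is needed: both inverses take the value zero on nonunits. -/
theorem JetRing.mk_inv (f : ℂ⟦X⟧) : (JetRing.mk f⁻¹ : JetRing n) = Ring.inverse (JetRing.mk f) := by
  by_cases h : PowerSeries.constantCoeff f = 0
  · rw [PowerSeries.inv_eq_zero.2 h, map_zero, Ring.inverse_non_unit]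
    rw [JetRing.isUnit_iff, JetRing.coeff_mk]
    simpa using h
  · have h1 : (JetRing.mk f * JetRing.mk f⁻¹ : JetRing n) = 1 := by
      rw [← map_mul, PowerSeries.mul_inv_cancel f h, map_one]
    exact (Ring.inverse_unit (⟨_, _, h1, by rw [mul_comm, h1]⟩ : (JetRing n)ˣ)).symm

theorem trans_inl (c c' : Chart n d) (p : ChartSpace c)
    (q : {i : Fin (n + 2) // i ≠ c'.υ} × Fin (n + 1)) :
    trans c c' p (Sum.inl q) =
      JetRing.coeff q.2 ((inclJets c p).1 q.1.1 * Ring.inverse ((inclJets c p).1 c'.υ)) := by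
  simp only [trans, coord, Sum.elim_inl]
  rw [← JetRing.coeff_mk, map_mul, JetRing.mk_inv]
  rfl

theorem trans_inr (c c' : Chart n d) (p : ChartSpace c) (β : {β : MonIdx n d // β ≠ c'.α}) :
    trans c c' p (Sum.inr β) =
      (inclJets c p).2 β.1 * Ring.inverse ((inclJets c p).2 c'.α) := by
  rw [Ring.inverse_eq_inv', ← div_eq_mul_inv]
  rfl

/-- The change of chart is division by `Z_υ'` and `A_α'`. With `g` and `s` their inverses, the
quotient rule gives the rescaled variation corrected to the new normalization. -/
theorem fderiv_trans {c c' : Chart n d} {p : ChartSpace c} {g : JetRing n} {s : ℂ}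
    (hg : (inclJets c p).1 c'.υ * g = 1) (hs : (inclJets c p).2 c'.α * s = 1)
    (v : ChartSpace c) :
    fderiv ℂ (trans c c') p v = chartDir c' (g • (inclJets c p).1, s • (inclJets c p).2)
      (g • (varIncl c v).1, s • (varIncl c v).2) := by
  have h1 : ∀ i, HasFDerivAt (fun q => (inclJets c q).1 i)
      ((ContinuousLinearMap.proj (R := ℂ) (φ := fun _ : Fin (n + 2) => JetRing n) i ∘L
        ContinuousLinearMap.fst ℂ (Fin (n + 2) → JetRing n) (MonIdx n d → ℂ)) ∘L
        LinearMap.toContinuousLinearMap (varIncl c)) p := fun i =>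
    (ContinuousLinearMap.hasFDerivAt
      (ContinuousLinearMap.proj (R := ℂ) (φ := fun _ : Fin (n + 2) => JetRing n) i ∘L
        ContinuousLinearMap.fst ℂ (Fin (n + 2) → JetRing n) (MonIdx n d → ℂ))).comp p
      (hasFDerivAt_inclJets c p)
  have h2 : ∀ β, HasFDerivAt (fun q => (inclJets c q).2 β)
      ((ContinuousLinearMap.proj (R := ℂ) (φ := fun _ : MonIdx n d => ℂ) β ∘L
        ContinuousLinearMap.snd ℂ (Fin (n + 2) → JetRing n) (MonIdx n d → ℂ)) ∘L
        LinearMap.toContinuousLinearMap (varIncl c)) p := fun β =>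
    (ContinuousLinearMap.hasFDerivAt
      (ContinuousLinearMap.proj (R := ℂ) (φ := fun _ : MonIdx n d => ℂ) β ∘L
        ContinuousLinearMap.snd ℂ (Fin (n + 2) → JetRing n) (MonIdx n d → ℂ))).comp p
      (hasFDerivAt_inclJets c p)
  have h3 : ∀ j : CoordIdx c', ∃ L : ChartSpace c →L[ℂ] ℂ,
      HasFDerivAt (fun q => trans c c' q j) L p ∧
      ∀ v, L v = chartDir c' (g • (inclJets c p).1, s • (inclJets c p).2)
        (g • (varIncl c v).1, s • (varIncl c v).2) j := by
    rintro (q | β)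
    · obtain ⟨L, hL, hLv⟩ := hasFDerivAt_mul_ringInverse (h1 q.1.1) (h1 c'.υ) hg
      refine ⟨JetRing.coeffL q.2 ∘L L, ?_, fun v => ?_⟩
      · simp only [trans_inl]
        exact (JetRing.coeffL q.2).hasFDerivAt.comp p hL
      · simp only [ContinuousLinearMap.comp_apply, hLv, JetRing.coeffL_apply, chartDir,
          Sum.elim_inl, Pi.smul_apply, smul_eq_mul]
        congr 1
        simp [mul_comm]
    · obtain ⟨L, hL, hLv⟩ := hasFDerivAt_mul_ringInverse (h2 β.1) (h2 c'.α) hs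
      refine ⟨L, ?_, fun v => ?_⟩
      · simpa only [trans_inr] using hL
      · rw [hLv]
        simp [chartDir, mul_comm]
  choose L hL hLv using h3
  have h4 : HasFDerivAt (trans c c') (ContinuousLinearMap.pi L) p := hasFDerivAt_pi.2 hL
  rw [h4.fderiv]
  funext j
  exact hLv j v

theorem exists_smul_of_chartPoint_eq {c c' : Chart n d} {p : chartLocus c} {q : chartLocus c'}
    (h : chartPoint c p = chartPoint c' q) : ∃ (g : JetRing n) (s : ℂ),
      (inclJets c' q.1).1 = g • (inclJets c p.1).1 ∧ (inclJets c' q.1).2 = s • (inclJets c p.1).2 ∧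
      (inclJets c p.1).1 c'.υ * g = 1 ∧ (inclJets c p.1).2 c'.α * s = 1 := by
  obtain ⟨⟨g, -, hg⟩, s, -, hs⟩ : HomogRel (incl c p.1) (incl c' q.1) := Quotient.exact h
  have h1 : (inclJets c' q.1).1 = (JetRing.mk g : JetRing n) • (inclJets c p.1).1 := by
    funext i
    ext k
    rw [inclJets, coeff_jets, hg, Pi.smul_apply, smul_eq_mul, inclJets, jets_fst,
      JetRing.ofCoeff_apply, ← map_mul, JetRing.coeff_mk]
  refine ⟨JetRing.mk g, s, h1, hs, ?_, ?_⟩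
  · rw [mul_comm, ← smul_eq_mul, ← Pi.smul_apply, ← h1, inclJets_υ]
  · have := inclJets_α c' q.1
    rw [show (inclJets c' q.1).2 = s • (inclJets c p.1).2 from hs] at this
    rw [mul_comm]
    exact this

/-! ### Equivariant vector fields as twisted sections -/

/-- Polynomial vector fields on the homogeneous data that are tangent to the vertical jets and
equivariant, with weights `a` and `b`, under the change of homogeneous representatives. -/
structure HomogField (n d a b : ℕ) where
  /-- the vector field -/
  toFun : JetData n d → JetData n d
  /-- the components are polynomials -/
  polynomial : ∀ {σ : Type} (w : (σ → ℂ) → JetData n d), IsPolyData w →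
    IsPolyData fun p => toFun (w p)
  /-- equivariance -/
  equivariant : ∀ (g : JetRing n) (s : ℂ) (w : JetData n d), toFun (g • w.1, s • w.2) =
    (JetRing.coeff 0 g ^ a * s ^ b) • (g • (toFun w).1, s • (toFun w).2)
  /-- tangency -/
  tangent : ∀ w, evalForm w = 0 → linForm w (toFun w) = 0

/-- The global section given by an equivariant vector field on the homogeneous data. -/
def HomogField.toTwistedField {a b : ℕ} (V : HomogField n d a b) : TwistedField n d a b where
  val c p := chartDir c (inclJets c p.1) (V.toFun (inclJets c p.1))
  regular c j := by
    have h0 := isPolyData_inclJets c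
    have h1 := V.polynomial _ h0
    obtain ⟨P, hP⟩ : ∃ P : MvPolynomial (CoordIdx c) ℂ, ∀ p : ChartSpace c,
        chartDir c (inclJets c p) (V.toFun (inclJets c p)) j = eval p P := by
      rw [← mem_polyFun_iff]
      rcases j with q | β
      · exact ((h1.1 q.1.1).sub ((h0.1 q.1.1).mul (h1.1 c.υ))) q.2
      · exact sub_mem_polyFun (h1.2 β.1) (mul_mem_polyFun (h0.2 β.1) (h1.2 c.α))
    exact ⟨P, fun p => hP p.1⟩
  tangent c p := chartDir_mem_tangentSpace p.2 (V.tangent _ (mem_chartLocus.1 p.2))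
  compat c c' p q h := by
    obtain ⟨g, s, hg, hs, hg1, hs1⟩ := exists_smul_of_chartPoint_eq h
    have e1 : inclJets c' q.1 = (g • (inclJets c p.1).1, s • (inclJets c p.1).2) :=
      Prod.ext hg hs
    have e2 : ((incl c p.1).1 c'.υ 0)⁻¹ = JetRing.coeff 0 g := by
      rw [← coeff_jets]
      refine (eq_inv_of_mul_eq_one_right ?_).symm
      rw [← inclJets, ← JetRing.coeff_zero_mul, hg1, JetRing.coeff_one, if_pos rfl]
    have e3 : ((incl c p.1).2 c'.α)⁻¹ = s := (eq_inv_of_mul_eq_one_right hs1).symm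
    rw [fderiv_trans hg1 hs1, ← inv_pow, ← inv_pow, e2, e3, e1, V.equivariant,
      varIncl_chartDir (inclJets_υ c p.1) (inclJets_α c p.1)]
    -- Passing through the chart `c` changed `v` by a rescaling direction only, and `chartDir c'`
    -- annihilates such directions at data normalized in `c'`; this is what `hg1` and `hs1` express
    -- below.
    set w := inclJets c p.1
    set v := V.toFun w
    refine (map_smul (chartDirₗ c' _) _ _).trans ?_
    congr 1
    change chartDir c' _ _ = _
    funext j
    rcases j with j | β
    · simp only [chartDir, Sum.elim_inl, Pi.smul_apply, smul_eq_mul, Prod.fst_sub, Pi.sub_apply]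
      congr 1
      linear_combination (-g * w.1 j.1.1 * v.1 c.υ) * hg1
    · simp only [chartDir, Sum.elim_inr, Pi.smul_apply, smul_eq_mul, Prod.snd_sub, Pi.sub_apply]
      linear_combination (-s * w.2 β.1 * v.2 c.α) * hs1

/-! ### Three families of equivariant vector fields -/

theorem JetRing.pow_eq_zero_of_coeff_zero {x : JetRing n} (h : JetRing.coeff 0 x = 0) :
    x ^ (n + 1) = 0 := by
  obtain ⟨f, rfl⟩ := JetRing.mk_surjective x
  rw [JetRing.coeff_mk] at h
  rw [← map_pow, JetRing.mk_eq_zero_iff_dvd]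
  exact pow_dvd_pow_of_dvd (PowerSeries.X_dvd_iff.2 (by simpa using h)) _

theorem aeval_smul_monomial (g : JetRing n) (Z : Fin (n + 2) → JetRing n)
    (m : Fin (n + 2) →₀ ℕ) : aeval (g • Z) (monomial m (1 : ℂ)) =
      g ^ m.degree * aeval Z (monomial m (1 : ℂ)) := by
  rw [aeval_monomial, aeval_monomial, Finsupp.degree_eq_sum,
    Finsupp.prod_fintype _ _ fun _ => pow_zero _, Finsupp.prod_fintype _ _ fun _ => pow_zero _]
  simp only [map_one, one_mul, Pi.smul_apply, smul_eq_mul, mul_pow, Finset.prod_mul_distrib,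
    Finset.prod_pow_eq_pow_sum]

section Polynomial

variable {σ : Type} {Z : (σ → ℂ) → Fin (n + 2) → JetRing n}

theorem pairMatrix_mem_polyFun (u v : Fin (n + 2)) (hZ : ∀ i, IsPolyJet fun p => Z p i)
    (a j : Fin (n + 1)) : (fun p => pairMatrix u v (Z p) a j) ∈ polyFun σ :=
  (((hZ u).pow _).mul ((hZ v).pow _)) a

theorem pairDet_mem_polyFun (u v : Fin (n + 2)) (hZ : ∀ i, IsPolyJet fun p => Z p i) :
    (fun p => pairDet u v (Z p)) ∈ polyFun σ :=
  det_mem_polyFun (pairMatrix_mem_polyFun u v hZ)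

theorem isPolyForm_pairForm (u v : Fin (n + 2)) (hZ : ∀ i, IsPolyJet fun p => Z p i)
    (μ : Fin (n + 2) →₀ ℕ) {r : (σ → ℂ) → JetRing n} (hr : IsPolyJet r) :
    IsPolyForm fun p => pairForm u v (Z p) μ (r p) :=
  IsPolyForm.sum _ fun j _ =>
    (IsPolyForm.const _).smul (cramer_mem_polyFun (pairMatrix_mem_polyFun u v hZ) hr j)

end Polynomial

/-- Equivariant vector fields in the direction of the coefficients of the form, given by a family of
forms vanishing along the jet; the weights are adjusted by powers of `Z_m(0)` and of `A_γ`. -/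
def HomogField.ofForm (m : Fin (n + 2)) (γ : MonIdx n d) {a e : ℕ} (b : ℕ) (he : e ≤ a)
    (F : (Fin (n + 2) → JetRing n) → MvPolynomial (Fin (n + 2)) ℂ)
    (hF : ∀ Z, (F Z).IsHomogeneous d)
    (hpoly : ∀ {σ : Type} (Z : (σ → ℂ) → Fin (n + 2) → JetRing n),
      (∀ i, IsPolyJet fun p => Z p i) → IsPolyForm fun p => F (Z p))
    (hequiv : ∀ (g : JetRing n) Z, F (g • Z) = JetRing.coeff 0 g ^ e • F Z)
    (hzero : ∀ Z, aeval Z (F Z) = 0) : HomogField n d a b where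
  -- The exponent is `b + 1` because `F` does not involve `A`, whereas a variation of `A` carries
  -- one factor `s` in addition to the twist `s ^ b`.
  toFun w := (0, (JetRing.coeff 0 (w.1 m) ^ (a - e) * w.2 γ ^ (b + 1)) • formCoeff n d (F w.1))
  polynomial w hw := ⟨fun _ => IsPolyJet.const 0, fun β => mul_mem_polyFun
    (mul_mem_polyFun (pow_mem_polyFun (hw.1 m 0) _) (pow_mem_polyFun (hw.2 γ) _))
    (hpoly _ hw.1 _)⟩
  equivariant g s w := by
    ext1
    · simp
    · have h1 : JetRing.coeff 0 g ^ a = JetRing.coeff 0 g ^ (a - e) * JetRing.coeff 0 g ^ e := by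
        rw [← pow_add, Nat.sub_add_cancel he]
      simp only [hequiv, map_smul, smul_smul, Pi.smul_apply, smul_eq_mul, JetRing.coeff_zero_mul,
        Prod.smul_mk, mul_pow, h1, pow_succ s]
      congr 1
      ring
  tangent w _ := by
    rw [linForm_apply]
    simp only [map_smul, form_formCoeff (hF w.1), hzero]
    simp

/-- The relations `pairDet · X^{μ+δ} = X^μ ∑_j c_j X_u^{n-j} X_v^j` along the jet. -/
def HomogField.pairRel (m : Fin (n + 2)) (γ : MonIdx n d) (u v : Fin (n + 2))
    {μ δ : Fin (n + 2) →₀ ℕ} (hμ : μ.degree + n = d) (hδ : δ.degree = n) :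
    HomogField n d (n ^ 2 + 2 * n) 1 :=
  -- The weight `n(n+1)` is that of the determinant, leaving a factor `Z_m(0)^n` to reach `n^2 +
  -- 2n`.
  HomogField.ofForm m γ (e := n * (n + 1)) 1 (by nlinarith)
    (fun Z => pairDet u v Z • monomial (μ + δ) 1 - pairForm u v Z μ (aeval Z (monomial δ (1 : ℂ))))
    (fun Z => by
      refine IsHomogeneous.sub ?_ (pairForm_isHomogeneous u v Z hμ _)
      rw [smul_monomial]
      exact isHomogeneous_monomial _ (by rw [map_add, hδ, hμ]))
    (fun Z hZ => by
      have h1 : IsPolyForm fun p => pairDet u v (Z p) • (monomial (μ + δ) (1 : ℂ)) :=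
        IsPolyForm.smul (pairDet_mem_polyFun u v hZ) (IsPolyForm.const _)
      have h2 : IsPolyForm fun p => pairForm u v (Z p) μ (aeval (Z p) (monomial δ (1 : ℂ))) :=
        isPolyForm_pairForm u v hZ μ (IsPolyJet.aeval_monomial hZ δ)
      exact h1.sub h2)
    (fun g Z => by
      rw [aeval_smul_monomial, hδ, pairForm_smul, pairDet_smul, smul_sub, smul_smul])
    (fun Z => by
      rw [map_sub, map_smul, aeval_pairForm, ← map_mul, monomial_mul, one_mul, sub_self])

/-- The forms `(Z_u(0) X_v - Z_v(0) X_u)^{n+1} X^μ`, which vanish along the jet. -/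
def HomogField.linePow (hn : 1 ≤ n) (m : Fin (n + 2)) (γ : MonIdx n d) (u v : Fin (n + 2))
    {μ : Fin (n + 2) →₀ ℕ} (hμ : μ.degree + (n + 1) = d) :
    HomogField n d (n ^ 2 + 2 * n) 1 :=
  HomogField.ofForm m γ (e := n + 1) 1 (by nlinarith)
    (fun Z => (JetRing.coeff 0 (Z u) • X v - JetRing.coeff 0 (Z v) • X u) ^ (n + 1) *
      monomial μ 1)
    (fun Z => by
      have h1 : (JetRing.coeff 0 (Z u) • X v - JetRing.coeff 0 (Z v) • X u :
          MvPolynomial (Fin (n + 2)) ℂ).IsHomogeneous 1 := by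
        rw [smul_eq_C_mul, smul_eq_C_mul]
        exact ((isHomogeneous_X _ _).C_mul _).sub ((isHomogeneous_X _ _).C_mul _)
      have h2 := (h1.pow (n + 1)).mul (isHomogeneous_monomial (R := ℂ) (d := μ) 1 rfl)
      exact (show 1 * (n + 1) + μ.degree = d by omega) ▸ h2)
    (fun Z hZ => by
      have h1 : ∀ i j, IsPolyForm fun p => JetRing.coeff 0 (Z p i) •
          (X j : MvPolynomial (Fin (n + 2)) ℂ) := fun i j =>
        IsPolyForm.smul (hZ i 0) (IsPolyForm.const _)
      exact (((h1 u v).sub (h1 v u)).pow (n + 1)).mul (IsPolyForm.const (monomial μ 1)))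
    (fun g Z => by
      simp only [Pi.smul_apply, smul_eq_mul, JetRing.coeff_zero_mul, mul_smul, ← smul_sub]
      rw [smul_pow, smul_mul_assoc])
    (fun Z => by
      -- Along the jet the linear form takes the value zero at the origin, so its power of order `n
      -- + 1` vanishes in the truncated ring.
      rw [map_mul, map_pow, JetRing.pow_eq_zero_of_coeff_zero, zero_mul]
      simp only [map_sub, map_smul, aeval_X, smul_eq_mul]
      ring)

theorem aeval_pderiv_form (Z : Fin (n + 2) → JetRing n) (A : MonIdx n d → ℂ) (i : Fin (n + 2)) :
    aeval Z (pderiv i (form A)) = ∑ β : MonIdx n d, (A β * β.1 i) •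
      aeval Z (monomial (β.exponent - Finsupp.single i 1) (1 : ℂ)) := by
  rw [form_apply, map_sum, map_sum]
  refine Finset.sum_congr rfl fun β _ => ?_
  rw [pderiv_monomial, ← map_smul, smul_monomial, smul_eq_mul, mul_one]
  rfl

/-- The forms that compensate the variation `Z_i ↦ pairDet · ζ^k Z_l` of the jet. -/
def shiftForm (u v i l : Fin (n + 2)) (k : ℕ) (μ δ : MonIdx n d → Fin (n + 2) →₀ ℕ)
    (w : JetData n d) : MvPolynomial (Fin (n + 2)) ℂ :=
  ∑ β : MonIdx n d, (w.2 β * β.1 i) • pairForm u v w.1 (μ β)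
    (JetRing.param n k * w.1 l * aeval w.1 (monomial (δ β) (1 : ℂ)))

/-- The lift of the variation `Z_i ↦ pairDet · ζ^k Z_l` of the jet. -/
def HomogField.shift (m : Fin (n + 2)) (γ : MonIdx n d) (u v i l : Fin (n + 2))
    (k : ℕ) (μ δ : MonIdx n d → Fin (n + 2) →₀ ℕ)
    (hμ : ∀ β, β.1 i ≠ 0 → β.exponent - Finsupp.single i 1 = μ β + δ β)
    (hδ : ∀ β, β.1 i ≠ 0 → (δ β).degree + 1 = n) : HomogField n d (n ^ 2 + 2 * n) 1 where
  toFun w :=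
    -- The determinant has weight `n(n+1)`, completed to `n^2 + 2n` by `Z_m(0)^n`; the factor `A_γ`
    -- gives weight one in `A`.
    ((JetRing.coeff 0 (w.1 m) ^ n * w.2 γ * pairDet u v w.1) •
        Pi.single i (JetRing.param n k * w.1 l),
      -(JetRing.coeff 0 (w.1 m) ^ n * w.2 γ) • formCoeff n d (shiftForm u v i l k μ δ w))
  polynomial w hw := by
    have h1 := mul_mem_polyFun (pow_mem_polyFun (hw.1 m 0) n) (hw.2 γ)
    refine ⟨fun j => ?_, fun β => mul_mem_polyFun (neg_mem_polyFun h1) (IsPolyForm.sum _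
      (fun β _ => (isPolyForm_pairForm u v hw.1 _ (((IsPolyJet.const _).mul (hw.1 l)).mul
        (IsPolyJet.aeval_monomial hw.1 _))).smul
          (mul_mem_polyFun (hw.2 β) (const_mem_polyFun _))) _)⟩
    refine IsPolyJet.smul (mul_mem_polyFun h1 (pairDet_mem_polyFun u v hw.1)) ?_
    by_cases h : j = i
    · subst h
      simpa using (IsPolyJet.const (JetRing.param n k)).mul (hw.1 l)
    · simpa [h] using IsPolyJet.const 0
  equivariant g s w := by
    have h1 : JetRing.coeff 0 g ^ (n ^ 2 + 2 * n) =
        JetRing.coeff 0 g ^ n * JetRing.coeff 0 g ^ (n * (n + 1)) := by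
      rw [← pow_add]; congr 1; ring
    have h2 : shiftForm u v i l k μ δ (g • w.1, s • w.2) =
        (s * JetRing.coeff 0 g ^ (n * (n + 1))) • shiftForm u v i l k μ δ w := by
      rw [shiftForm, shiftForm, Finset.smul_sum]
      refine Finset.sum_congr rfl fun β _ => ?_
      by_cases hβ : β.1 i = 0
      · simp [hβ]
      -- Since `δ β` has degree `n - 1`, its value times `Z_l` is homogeneous of degree `n`, exactly
      -- the degree for which Cramer's coefficients are equivariant.
      have h3 : JetRing.param n k * (g • w.1) l * aeval (g • w.1) (monomial (δ β) (1 : ℂ)) =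
          g ^ n * (JetRing.param n k * w.1 l * aeval w.1 (monomial (δ β) (1 : ℂ))) := by
        rw [aeval_smul_monomial, Pi.smul_apply, smul_eq_mul]
        conv_rhs => rw [show g ^ n = g ^ (δ β).degree * g by rw [← pow_succ, hδ β hβ]]
        ring
      rw [h3, pairForm_smul, smul_smul, smul_smul]
      simp only [Pi.smul_apply, smul_eq_mul]
      congr 1
      ring
    ext1
    · funext j
      by_cases h : j = i
      · subst h
        simp only [Pi.smul_apply, smul_eq_mul, JetRing.coeff_zero_mul, pairDet_smul, h1,
          Prod.smul_mk, Pi.single_eq_same, mul_smul_comm, smul_smul]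
        rw [show JetRing.param n k * (g * w.1 l) = g * (JetRing.param n k * w.1 l) by ring]
        congr 1
        ring
      · simp [h]
    · simp only [h2, map_smul, smul_smul, Pi.smul_apply, smul_eq_mul, JetRing.coeff_zero_mul,
        Prod.smul_mk, h1]
      congr 1
      ring
  tangent w _ := by
    have hhom : (shiftForm u v i l k μ δ w).IsHomogeneous d := by
      refine IsHomogeneous.sum _ _ _ fun β _ => ?_
      by_cases hβ : β.1 i = 0
      · simpa [hβ] using isHomogeneous_zero _ _ _
      rw [smul_eq_C_mul]
      refine IsHomogeneous.C_mul (pairForm_isHomogeneous u v _ ?_ _) _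
      have h1 : β.exponent = Finsupp.single i 1 + (μ β + δ β) := by
        rw [← hμ β hβ, add_tsub_cancel_of_le]
        rw [Finsupp.single_le_iff]
        exact Nat.one_le_iff_ne_zero.2 hβ
      have h2 := β.degree_exponent
      rw [h1, map_add, map_add, Finsupp.degree_single] at h2
      have := hδ β hβ
      omega
    -- Each monomial of the partial derivative splits as `X^{μ β} X^{δ β}`: the first factor stays a
    -- monomial and the second joins the jet being expanded. The total is the contribution of the
    -- moved coordinate, which the minus sign in the field cancels.
    have h1 : aeval w.1 (shiftForm u v i l k μ δ w) = pairDet u v w.1 •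
        (aeval w.1 (pderiv i (form w.2)) * (JetRing.param n k * w.1 l)) := by
      rw [shiftForm, map_sum, aeval_pderiv_form, Finset.sum_mul, Finset.smul_sum]
      refine Finset.sum_congr rfl fun β _ => ?_
      by_cases hβ : β.1 i = 0
      · simp [hβ]
      have h2 : (monomial (μ β + δ β) 1 : MvPolynomial (Fin (n + 2)) ℂ) =
          monomial (μ β) 1 * monomial (δ β) 1 := by rw [monomial_mul, one_mul]
      rw [map_smul, aeval_pairForm, hμ β hβ, smul_comm, smul_mul_assoc, h2, map_mul]
      congr 2
      ring
    rw [linForm_apply, map_smul, map_smul, form_formCoeff hhom, h1, Finset.sum_eq_single i]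
    · simp only [Pi.smul_apply, Pi.single_eq_same, mul_smul_comm, smul_smul, ← add_smul]
      rw [neg_mul, neg_add_cancel, zero_smul]
    · intro j _ hj
      simp [hj]
    · simp

/-! ### Spanning by the equivariant fields -/

theorem exists_add_degree_eq (k : ℕ) (m : Fin (n + 2) →₀ ℕ) (h : k ≤ m.degree) :
    ∃ μ δ : Fin (n + 2) →₀ ℕ, m = μ + δ ∧ δ.degree = k := by
  induction k with
  | zero => exact ⟨m, 0, by simp, by simp⟩
  | succ k ih =>
    obtain ⟨μ, δ, rfl, hδ⟩ := ih (by omega)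
    have hμ : μ ≠ 0 := by
      rintro rfl
      rw [zero_add, hδ] at h
      omega
    obtain ⟨i, hi⟩ := Finsupp.ne_iff.1 hμ
    have hle : Finsupp.single i 1 ≤ μ := by
      rw [Finsupp.single_le_iff]
      exact Nat.one_le_iff_ne_zero.2 hi
    refine ⟨μ - Finsupp.single i 1, Finsupp.single i 1 + δ, ?_, ?_⟩
    · rw [← add_assoc, tsub_add_cancel_of_le hle]
    · rw [map_add, Finsupp.degree_single, hδ, add_comm]

/-- The span of the values of the equivariant vector fields. -/
def valueSpan (w : JetData n d) : Submodule ℂ (JetData n d) :=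
  Submodule.span ℂ (Set.range fun V : HomogField n d (n ^ 2 + 2 * n) 1 => V.toFun w)

theorem linForm_eq_zero_of_mem_valueSpan {w : JetData n d} (hw : evalForm w = 0) {v : JetData n d}
    (hv : v ∈ valueSpan w) : linForm w v = 0 := by
  have : valueSpan w ≤ LinearMap.ker (linForm w) := by
    rw [valueSpan, Submodule.span_le]
    rintro _ ⟨V, rfl⟩
    exact V.tangent w hw
  exact this hv

/-- The forms whose coefficients are values of the equivariant vector fields. -/
def formSpan (w : JetData n d) : Submodule ℂ (MvPolynomial (Fin (n + 2)) ℂ) :=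
  (valueSpan w).comap (LinearMap.inr ℂ _ _ ∘ₗ formCoeff n d)

theorem mem_formSpan {w : JetData n d} {P : MvPolynomial (Fin (n + 2)) ℂ} :
    P ∈ formSpan w ↔ ((0 : Fin (n + 2) → JetRing n), formCoeff n d P) ∈ valueSpan w := Iff.rfl

section Spanning

variable {w : JetData n d} {u v : Fin (n + 2)} {γ : MonIdx n d}

theorem pairRel_mem_formSpan (hu : w.1 u = 1) (hγ : w.2 γ = 1)
    {μ δ : Fin (n + 2) →₀ ℕ} (hμ : μ.degree + n = d) (hδ : δ.degree = n) :
    pairDet u v w.1 • monomial (μ + δ) 1 - pairForm u v w.1 μ (aeval w.1 (monomial δ (1 : ℂ))) ∈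
      formSpan w := by
  have h : (HomogField.pairRel u γ u v hμ hδ).toFun w ∈ valueSpan w :=
    Submodule.subset_span ⟨_, rfl⟩
  simp only [HomogField.pairRel, HomogField.ofForm, hu, hγ, JetRing.coeff_one, if_true, one_pow,
    one_mul, one_smul] at h
  exact h

theorem linePow_mem_formSpan (hn : 1 ≤ n) (hu : w.1 u = 1) (hγ : w.2 γ = 1)
    {μ : Fin (n + 2) →₀ ℕ} (hμ : μ.degree + (n + 1) = d) :
    (X v - JetRing.coeff 0 (w.1 v) • X u) ^ (n + 1) * monomial μ 1 ∈ formSpan w := by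
  have h : (HomogField.linePow hn u γ u v hμ).toFun w ∈ valueSpan w :=
    Submodule.subset_span ⟨_, rfl⟩
  simp only [HomogField.linePow, HomogField.ofForm, hu, hγ, JetRing.coeff_one, if_true, one_pow,
    one_mul, one_smul] at h
  exact h

/-- The span of the monomials `X_u^{d-j} X_v^j`, `0 ≤ j ≤ n`. -/
def pairSpan (d : ℕ) (u v : Fin (n + 2)) : Submodule ℂ (MvPolynomial (Fin (n + 2)) ℂ) :=
  Submodule.span ℂ (Set.range fun j : Fin (n + 1) => X u ^ (d - j : ℕ) * X v ^ (j : ℕ))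

/-- Strong induction on a weight. A variable other than `X_u`, `X_v` is eliminated by `pairRel`, as
part of a factor of degree `n`; a power of `X_v` above `n` is lowered by `linePow`. -/
theorem monomial_mem_formSpan_sup_pairSpan (hn : 1 ≤ n) (hd : n < d) (huv : v ≠ u)
    (hu : w.1 u = 1) (hv : JetRing.coeff 1 (w.1 v) ≠ 0) (hγ : w.2 γ = 1)
    (m : Fin (n + 2) →₀ ℕ) (hm : m.degree = d) :
    (monomial m 1 : MvPolynomial (Fin (n + 2)) ℂ) ∈ formSpan w ⊔ pairSpan d u v := by
  -- A foreign variable weighs `n + 1`, more than any `X_u^{n-j} X_v^j` with `j ≤ n` that replaces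
  -- it, so both reductions strictly lower the weight.
  let W : Fin (n + 2) → ℕ := fun i => if i = u then 0 else if i = v then 1 else n + 1
  have hWu : W u = 0 := by simp [W]
  have hWv : W v = 1 := by simp [W, huv]
  have hpair : ∀ (μ : Fin (n + 2) →₀ ℕ) (a b : ℕ),
      (X u ^ a * X v ^ b * monomial μ 1 : MvPolynomial (Fin (n + 2)) ℂ) =
        monomial (Finsupp.single u a + Finsupp.single v b + μ) 1 := fun μ a b => by
    rw [X_pow_eq_monomial, X_pow_eq_monomial, monomial_mul, monomial_mul, one_mul, one_mul]
  induction hN : Finsupp.weight W m using Nat.strong_induction_on generalizing m with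
  | _ N ih =>
  subst hN
  by_cases hk : ∃ k, k ≠ u ∧ k ≠ v ∧ m k ≠ 0
  · obtain ⟨k, hku, hkv, hmk⟩ := hk
    have hle : Finsupp.single k 1 ≤ m := by
      rw [Finsupp.single_le_iff]
      exact Nat.one_le_iff_ne_zero.2 hmk
    obtain ⟨m', rfl⟩ := exists_add_of_le hle
    rw [map_add, Finsupp.degree_single] at hm
    obtain ⟨μ, δ, rfl, hδ⟩ := exists_add_degree_eq (n - 1) m' (by omega)
    rw [map_add] at hm
    have hμ : μ.degree + n = d := by omega
    have hδ' : (Finsupp.single k 1 + δ).degree = n := by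
      rw [map_add, Finsupp.degree_single, hδ]; omega
    have h0 := pairDet_ne_zero hn hu hv
    have hrel := pairRel_mem_formSpan (v := v) hu hγ hμ hδ'
    have hform : ∀ r, pairForm u v w.1 μ r ∈ formSpan w ⊔ pairSpan d u v := by
      intro r
      refine Submodule.sum_mem _ fun j _ => Submodule.smul_mem _ _ ?_
      rw [mul_comm, hpair]
      have hj := j.2
      refine ih _ ?_ _ ?_ rfl
      · simp only [map_add, Finsupp.weight_single, hWu, hWv, smul_eq_mul]
        have : W k = n + 1 := by simp [W, hku, hkv]
        rw [this]
        omega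
      · simp only [map_add, Finsupp.degree_single]
        omega
    have h1 := add_mem (Submodule.mem_sup_left hrel) (hform (aeval w.1
      (monomial (Finsupp.single k 1 + δ) (1 : ℂ))))
    rw [sub_add_cancel] at h1
    have h2 := Submodule.smul_mem _ (pairDet u v w.1)⁻¹ h1
    rw [smul_smul, inv_mul_cancel₀ h0, one_smul] at h2
    rwa [add_left_comm]
  · push Not at hk
    have hm1 : m = Finsupp.single u (m u) + Finsupp.single v (m v) := by
      ext i
      rw [Finsupp.add_apply, Finsupp.single_apply, Finsupp.single_apply]
      by_cases h1 : u = i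
      · subst h1; simp [huv]
      · by_cases h2 : v = i
        · subst h2; simp [Ne.symm huv]
        · simp [h1, h2, hk i (Ne.symm h1) (Ne.symm h2)]
    have hdeg : m u + m v = d := by
      rw [← hm, hm1]; simp [huv, Ne.symm huv]
    by_cases hmv : m v ≤ n
    · refine Submodule.mem_sup_right (Submodule.subset_span ⟨⟨m v, by omega⟩, ?_⟩)
      have := hpair 0 (m u) (m v)
      rw [monomial_zero', C_1, mul_one, add_zero, ← hm1] at this
      rw [← this]
      simp only
      congr 2
      omega
    -- Expanding `(X_v - Z_v(0) X_u)^{n+1} X^μ`, the leading term is the given monomial and the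
    -- other terms contain fewer factors `X_v`.
    · let μ : Fin (n + 2) →₀ ℕ := Finsupp.single u (m u) + Finsupp.single v (m v - (n + 1))
      have hμ : μ.degree + (n + 1) = d := by
        simp only [μ, map_add, Finsupp.degree_single]; omega
      have hrel := linePow_mem_formSpan (v := v) hn hu hγ hμ
      have hterm : ∀ k : ℕ, (X v ^ k * (-(JetRing.coeff 0 (w.1 v) • X u)) ^ (n + 1 - k) *
          ((n + 1).choose k : MvPolynomial (Fin (n + 2)) ℂ)) * monomial μ 1 =
          (((-JetRing.coeff 0 (w.1 v)) ^ (n + 1 - k)) * ((n + 1).choose k : ℂ)) •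
            monomial (Finsupp.single u (n + 1 - k) + Finsupp.single v k + μ) 1 := by
        intro k
        rw [← hpair, ← neg_smul, smul_pow, smul_eq_C_mul, smul_eq_C_mul, C_mul,
          show ((n + 1).choose k : MvPolynomial (Fin (n + 2)) ℂ) = C ((n + 1).choose k : ℂ) by simp]
        ring
      rw [sub_eq_add_neg, add_pow, Finset.sum_mul, Finset.sum_range_succ] at hrel
      simp only [hterm] at hrel
      have hlast : Finsupp.single u (n + 1 - (n + 1)) + Finsupp.single v (n + 1) + μ = m := by
        conv_rhs => rw [hm1]
        have : m v = n + 1 + (m v - (n + 1)) := by omega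
        conv_rhs => rw [this]
        simp only [μ, Nat.sub_self, Finsupp.single_zero, zero_add, Finsupp.single_add]
        abel
      rw [hlast, Nat.sub_self, pow_zero, Nat.choose_self, Nat.cast_one, one_mul, one_smul] at hrel
      refine (Submodule.add_mem_iff_right _ ?_).1 (Submodule.mem_sup_left hrel)
      refine Submodule.sum_mem _ fun k hk' => Submodule.smul_mem _ _ ?_
      have hk'' := Finset.mem_range.1 hk'
      refine ih _ ?_ _ ?_ rfl
      · conv_rhs => rw [hm1]
        simp only [μ, map_add, Finsupp.weight_single, hWu, hWv, smul_eq_mul]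
        omega
      · simp only [map_add, Finsupp.degree_single]
        omega

/-- Elements of degree `d` of `formSpan w` vanish along the jet, by tangency. Hence the remainder in
`pairSpan d u v` vanishes along it too, and the independence of the powers of `Z_v` makes it zero.
-/
theorem mem_formSpan_of_aeval_eq_zero (hn : 1 ≤ n) (hd : n < d) (huv : v ≠ u)
    (hu : w.1 u = 1) (hv : JetRing.coeff 1 (w.1 v) ≠ 0) (hγ : w.2 γ = 1) (hw : evalForm w = 0)
    {P : MvPolynomial (Fin (n + 2)) ℂ} (hP : P.IsHomogeneous d) (h0 : aeval w.1 P = 0) :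
    P ∈ formSpan w := by
  have h1 : P ∈ formSpan w ⊔ pairSpan d u v := by
    rw [← P.support_sum_monomial_coeff]
    refine Submodule.sum_mem _ fun m hm => ?_
    rw [← mul_one (P.coeff m), ← smul_eq_mul, ← smul_monomial]
    refine Submodule.smul_mem _ _ (monomial_mem_formSpan_sup_pairSpan hn hd huv hu hv hγ m ?_)
    by_contra h
    exact (mem_support_iff.1 hm) (hP.coeff_eq_zero h)
  obtain ⟨t, ht, b, hb, rfl⟩ := Submodule.mem_sup.1 h1
  obtain ⟨x, rfl⟩ := (Submodule.mem_span_range_iff_exists_fun ℂ).1 hb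
  have hbhom : (∑ j : Fin (n + 1), x j • (X u ^ (d - j : ℕ) * X v ^ (j : ℕ)) :
      MvPolynomial (Fin (n + 2)) ℂ).IsHomogeneous d := by
    refine IsHomogeneous.sum _ _ _ fun j _ => ?_
    rw [smul_eq_C_mul]
    refine IsHomogeneous.C_mul ?_ _
    have := (isHomogeneous_X_pow (R := ℂ) u (d - j : ℕ)).mul (isHomogeneous_X_pow v (j : ℕ))
    rwa [Nat.sub_add_cancel (by have := j.2; omega)] at this
  have hthom : t.IsHomogeneous d := by simpa using hP.sub hbhom
  have ht0 : aeval w.1 t = 0 := by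
    have := linForm_eq_zero_of_mem_valueSpan hw (mem_formSpan.1 ht)
    rw [linForm_apply, form_formCoeff hthom] at this
    simpa using this
  rw [map_add, ht0, zero_add, map_sum] at h0
  have hx : x = 0 := by
    refine JetRing.eq_zero_of_sum_smul_pow_eq_zero hn (w.1 v) hv x ?_
    simpa [hu] using h0
  simpa [hx] using ht

/-- The `shift` fields realize every variation of the jet. After subtracting them, only a variation
of the form remains, and the linearized equation says that it vanishes along the jet. -/
theorem mem_valueSpan_of_linForm_eq_zero (hn : 1 ≤ n) (hd : n < d) (huv : v ≠ u)
    (hu : w.1 u = 1) (hv : JetRing.coeff 1 (w.1 v) ≠ 0) (hγ : w.2 γ = 1) (hw : evalForm w = 0)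
    {y : JetData n d} (hy : linForm w y = 0) : y ∈ valueSpan w := by
  -- The exponents chosen when `β_i = 0` are arbitrary: the corresponding term of the derivative has
  -- coefficient zero.
  have hsplit : ∀ (i : Fin (n + 2)) (β : MonIdx n d), ∃ μ δ : Fin (n + 2) →₀ ℕ, β.1 i ≠ 0 →
      β.exponent - Finsupp.single i 1 = μ + δ ∧ δ.degree + 1 = n := by
    intro i β
    by_cases hβ : β.1 i = 0
    · exact ⟨0, 0, fun h => absurd hβ h⟩
    have hle : Finsupp.single i 1 ≤ β.exponent := by
      rw [Finsupp.single_le_iff]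
      exact Nat.one_le_iff_ne_zero.2 hβ
    obtain ⟨m', hm'⟩ := exists_add_of_le hle
    have h2 := β.degree_exponent
    rw [hm', map_add, Finsupp.degree_single] at h2
    obtain ⟨μ, δ, h3, h4⟩ := exists_add_degree_eq (n - 1) m' (by omega)
    exact ⟨μ, δ, fun _ => ⟨by rw [hm', add_tsub_cancel_left, h3], by omega⟩⟩
  choose μ δ hμδ using hsplit
  have h0 := pairDet_ne_zero hn hu hv
  let V : Fin (n + 2) → Fin (n + 1) → HomogField n d (n ^ 2 + 2 * n) 1 := fun i k =>
    HomogField.shift u γ u v i u k (μ i) (δ i) (fun β h => (hμδ i β h).1)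
      fun β h => (hμδ i β h).2
  have hV : ∀ i k, ((V i k).toFun w).1 = pairDet u v w.1 • Pi.single i (JetRing.param n k) := by
    intro i k
    simp [V, HomogField.shift, hu, hγ, JetRing.coeff_one]
  -- As `Z_u = 1`, the field `V i k` moves `Z_i` by the determinant times `ζ^k`; the coefficients of
  -- `y` divided by the determinant therefore reproduce its jet part.
  set z : JetData n d := ∑ i, ∑ k, (JetRing.coeff k (y.1 i) * (pairDet u v w.1)⁻¹) •
    (V i k).toFun w with hz
  have hzmem : z ∈ valueSpan w := Submodule.sum_mem _ fun i _ => Submodule.sum_mem _ fun k _ =>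
    Submodule.smul_mem _ _ (Submodule.subset_span ⟨V i k, rfl⟩)
  have hz1 : z.1 = y.1 := by
    rw [hz, Prod.fst_sum]
    simp only [Prod.fst_sum, Prod.smul_fst, hV, smul_smul, mul_assoc, inv_mul_cancel₀ h0, mul_one]
    funext j
    rw [Finset.sum_apply, Finset.sum_eq_single j]
    · rw [Finset.sum_apply]
      simp only [Pi.smul_apply, Pi.single_eq_same]
      exact (JetRing.eq_sum_param _).symm
    · intro i _ hij
      simp [Ne.symm hij]
    · simp
  have hsub : y - z = (0, (y - z).2) := Prod.ext (by simp [hz1]) rfl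
  have h1 : linForm w (y - z) = 0 := by
    rw [map_sub, hy, linForm_eq_zero_of_mem_valueSpan hw hzmem, sub_zero]
  have h2 : y - z ∈ valueSpan w := by
    rw [hsub] at h1 ⊢
    rw [linForm_apply] at h1
    have h3 := mem_formSpan_of_aeval_eq_zero hn hd huv hu hv hγ hw
      (form_isHomogeneous (y - z).2) (by simpa using h1)
    rwa [mem_formSpan, formCoeff_form] at h3
  simpa using add_mem h2 hzmem

end Spanning

theorem span_val_eq_tangentSpace (hn : 1 ≤ n) (hd : n < d) {c : Chart n d} (p : chartLocus c)
    {v : Fin (n + 2)} (hvu : v ≠ c.υ) (hv : JetRing.coeff 1 ((inclJets c p.1).1 v) ≠ 0) :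
    Submodule.span ℂ (Set.range fun T : TwistedField n d (n ^ 2 + 2 * n) 1 => T.val c p) =
      tangentSpace c p.1 := by
  refine le_antisymm (Submodule.span_le.2 ?_) fun y hy => ?_
  · rintro _ ⟨T, rfl⟩
    exact T.tangent c p
  · have h1 := mem_valueSpan_of_linForm_eq_zero hn hd hvu (inclJets_υ c p.1) hv
      (inclJets_α c p.1) (mem_chartLocus.1 p.2) (mem_tangentSpace.1 hy)
    have h2 := Submodule.mem_map_of_mem (f := chartDirₗ c (inclJets c p.1)) h1
    rw [show chartDirₗ c (inclJets c p.1) (varIncl c y) = y from chartDir_varIncl _ _ _,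
      valueSpan, Submodule.map_span] at h2
    refine Submodule.span_mono ?_ h2
    rintro _ ⟨_, ⟨V, rfl⟩, rfl⟩
    exact ⟨V.toTwistedField, rfl⟩

/-! ### The bad set in all charts -/

/-- The values and the first order coefficients of the homogeneous coordinates are proportional. -/
def FirstOrderParallel (w : Homog n d) : Prop :=
  ∀ i j, w.1 i 0 * w.1 j 1 = w.1 j 0 * w.1 i 1

theorem val_one_fin (hn : 1 ≤ n) : ((1 : Fin (n + 1)) : ℕ) = 1 := by
  rw [Fin.val_one', Nat.mod_eq_of_lt (by omega)]

/-- Rescaling by `g` multiplies the two by two minors of `(Z(0), Z'(0))` by `g(0)^2`; the term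
involving `g'(0)` cancels. -/
theorem FirstOrderParallel.of_homogRel (hn : 1 ≤ n) {w w' : Homog n d} (h : HomogRel w w')
    (hw : FirstOrderParallel w) : FirstOrderParallel w' := by
  obtain ⟨⟨g, -, hg⟩, -⟩ := h
  have h0 : ∀ i, w'.1 i 0 = PowerSeries.constantCoeff g * w.1 i 0 := fun i => by
    rw [hg i 0]
    simp [ser]
  have h1 : ∀ i, w'.1 i 1 =
      PowerSeries.coeff 1 g * w.1 i 0 + w.1 i 1 * PowerSeries.constantCoeff g := fun i => by
    have e1 := coeff_ser (w.1 i) 1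
    rw [val_one_fin hn] at e1
    rw [hg i 1, val_one_fin hn, PowerSeries.coeff_one_mul, e1]
    simp [ser]
  intro i j
  rw [h0, h0, h1, h1]
  linear_combination (PowerSeries.constantCoeff g) ^ 2 * hw i j

theorem firstOrderParallel_incl (hn : 1 ≤ n) (c : Chart n d) (p : ChartSpace c) :
    FirstOrderParallel (incl c p) ↔ FirstOrderVanish p := by
  have h10 : (1 : Fin (n + 1)) ≠ 0 := by
    rw [Ne, Fin.ext_iff, val_one_fin hn]; simp
  have hυ0 : (incl c p).1 c.υ 0 = 1 := by simp [incl]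
  have hυ1 : (incl c p).1 c.υ 1 = 0 := by simp [incl, h10]
  have hi : ∀ (i : Fin (n + 2)) (h : i ≠ c.υ), (incl c p).1 i 1 = p (Sum.inl (⟨i, h⟩, 1)) :=
    fun i h => by simp [incl, h]
  constructor
  · rintro h ⟨i, hne⟩
    have := h c.υ i
    rwa [hυ0, hυ1, mul_zero, one_mul, hi i hne] at this
  · intro h
    have h1 : ∀ i, (incl c p).1 i 1 = 0 := fun i => by
      by_cases hne : i = c.υ
      · rw [hne, hυ1]
      · rw [hi i hne, h ⟨i, hne⟩]
    intro i j
    rw [h1, h1, mul_zero, mul_zero]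

theorem aeval_smul_form (g : JetRing n) (w : JetData n d) :
    aeval (g • w.1) (form w.2) = g ^ d * evalForm w := by
  rw [show aeval (g • w.1) (form w.2) = evalForm (g • w.1, w.2) from rfl, evalForm_eq_sum_aeval,
    evalForm_eq_sum_aeval, Finset.mul_sum]
  refine Finset.sum_congr rfl fun β _ => ?_
  rw [aeval_smul_monomial, β.degree_exponent, mul_smul_comm]

/-- The linear form with coefficients `φ`. -/
def linearForm (φ : Fin (n + 2) → ℂ) : MvPolynomial (Fin (n + 2)) ℂ := ∑ j, φ j • X j

/-- The pullback of a form under the linear map `id + ε v φ`. -/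
def shear (φ v : Fin (n + 2) → ℂ) (ε : ℂ) :
    MvPolynomial (Fin (n + 2)) ℂ →ₐ[ℂ] MvPolynomial (Fin (n + 2)) ℂ :=
  aeval fun i => X i + (ε * v i) • linearForm φ

/-- The action of the linear map `id + ε v φ` on homogeneous data. -/
def shearData (φ v : Fin (n + 2) → ℂ) (w : Homog n d) (ε : ℂ) : Homog n d :=
  -- `(1 + ε φ(v)) id - ε v φ` is `1 + ε φ(v)` times the inverse of `id + ε v φ`, which avoids
  -- division and stays polynomial in `ε`.
  (fun i k => (1 + ε * ∑ j, φ j * v j) * w.1 i k - ε * v i * ∑ j, φ j * w.1 j k,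
    formCoeff n d (shear φ v ε (form w.2)))

theorem shearData_zero (φ v : Fin (n + 2) → ℂ) (w : Homog n d) : shearData φ v w 0 = w := by
  ext1
  · funext i k
    simp [shearData]
  · have : shear φ v 0 = AlgHom.id ℂ (MvPolynomial (Fin (n + 2)) ℂ) := by
      ext i; simp [shear]
    simp [shearData, this, formCoeff_form]

theorem linearForm_isHomogeneous (φ : Fin (n + 2) → ℂ) : (linearForm φ).IsHomogeneous 1 := by
  refine IsHomogeneous.sum _ _ _ fun j _ => ?_
  rw [smul_eq_C_mul]
  exact (isHomogeneous_X _ _).C_mul _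

theorem shear_isHomogeneous (φ v : Fin (n + 2) → ℂ) (ε : ℂ)
    {P : MvPolynomial (Fin (n + 2)) ℂ} (hP : P.IsHomogeneous d) :
    (shear φ v ε P).IsHomogeneous d := by
  have := hP.aeval (fun i => X i + (ε * v i) • linearForm φ) (n := 1) fun i => by
    rw [smul_eq_C_mul]
    exact (isHomogeneous_X _ _).add ((linearForm_isHomogeneous φ).C_mul _)
  rwa [one_mul] at this

theorem continuous_coeff_shear (φ v : Fin (n + 2) → ℂ) (P : MvPolynomial (Fin (n + 2)) ℂ)
    (m : Fin (n + 2) →₀ ℕ) : Continuous fun ε => (shear φ v ε P).coeff m := by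
  induction P using MvPolynomial.induction_on generalizing m with
  | C a => simpa [shear] using continuous_const
  | add p q hp hq => 
    simp only [map_add, coeff_add]
    exact (hp m).add (hq m)
  | mul_X p i hp =>
    simp only [map_mul, coeff_mul]
    refine continuous_finsetSum _ fun x _ => (hp x.1).mul ?_
    simp only [shear, aeval_X, coeff_add, coeff_smul, smul_eq_mul]
    fun_prop

theorem continuous_shearData (φ v : Fin (n + 2) → ℂ) (w : Homog n d) :
    Continuous (shearData φ v w) := by
  refine Continuous.prodMk (continuous_pi fun i => continuous_pi fun k => ?_)
    (continuous_pi fun β => continuous_coeff_shear φ v _ _)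
  fun_prop

/-- The maps applied to the form and to the jet compose to the scalar `1 + ε φ(v)`, and the form has
degree `d`. -/
theorem evalForm_shearData (φ v : Fin (n + 2) → ℂ) (w : Homog n d) (ε : ℂ) :
    evalForm (jets (shearData φ v w ε)) =
      algebraMap ℂ (JetRing n) (1 + ε * ∑ j, φ j * v j) ^ d * evalForm (jets w) := by
  rw [← aeval_smul_form, evalForm, jets_snd,
    show (shearData φ v w ε).2 = formCoeff n d (shear φ v ε (form w.2)) from rfl,
    form_formCoeff (shear_isHomogeneous φ v ε (form_isHomogeneous _)), shear, ← AlgHom.comp_apply,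
    comp_aeval, jets_snd]
  congr 2
  funext i
  ext k
  have hZ : ∀ i, JetRing.coeff k ((jets (shearData φ v w ε)).1 i) =
      (1 + ε * ∑ j, φ j * v j) * w.1 i k - ε * v i * ∑ j, φ j * w.1 j k := fun i => coeff_jets _ _ _
  have hφ : ∑ j, φ j * ((1 + ε * ∑ j, φ j * v j) * w.1 j k - ε * v j * ∑ j, φ j * w.1 j k) =
      ∑ j, φ j * w.1 j k := by
    have h1 : ∀ j, φ j * ((1 + ε * ∑ j, φ j * v j) * w.1 j k - ε * v j * ∑ j, φ j * w.1 j k) =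
        (1 + ε * ∑ j, φ j * v j) * (φ j * w.1 j k) - (ε * ∑ j, φ j * w.1 j k) * (φ j * v j) :=
      fun j => by ring
    rw [Finset.sum_congr rfl fun j _ => h1 j, Finset.sum_sub_distrib, ← Finset.mul_sum,
      ← Finset.mul_sum]
    ring
  rw [Pi.smul_apply, smul_eq_mul, ← Algebra.smul_def, map_smul, coeff_jets]
  simp only [linearForm, map_add, map_smul, map_sum, aeval_X, smul_eq_mul, hZ, hφ]
  ring

theorem FirstOrderParallel.shearData (φ v : Fin (n + 2) → ℂ) {w : Homog n d}
    (hw : FirstOrderParallel w) (ε : ℂ) : FirstOrderParallel (shearData φ v w ε) := by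
  have h1 : ∀ i, w.1 i 0 * ∑ j, φ j * w.1 j 1 = w.1 i 1 * ∑ j, φ j * w.1 j 0 := fun i => by
    rw [Finset.mul_sum, Finset.mul_sum]
    exact Finset.sum_congr rfl fun j _ => by linear_combination φ j * hw i j
  intro i j
  simp only [VertJets.shearData]
  linear_combination (1 + ε * ∑ j, φ j * v j) ^ 2 * hw i j -
    (1 + ε * ∑ j, φ j * v j) * ε * v j * h1 i + (1 + ε * ∑ j, φ j * v j) * ε * v i * h1 j

/-- The coefficient of `X_1^d` is the value of the form at the coordinate point, which turns the
base chart condition on `A` into a nonvanishing value. -/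
theorem eval_single_one (A : MonIdx n d → ℂ) :
    eval (Pi.single 1 1) (form A) = A (baseChart n d).α := by
  rw [form_apply, map_sum, Finset.sum_eq_single (baseChart n d).α]
  · rw [eval_monomial, Finsupp.prod_fintype _ _ fun _ => pow_zero _, Finset.prod_eq_one, mul_one]
    intro i _
    by_cases h : i = 1
    · subst h; simp
    · simp [baseChart, h]
  · intro β _ hβ
    rw [eval_monomial, Finsupp.prod_fintype _ _ fun _ => pow_zero _]
    obtain ⟨i, hi, hi'⟩ : ∃ i, i ≠ 1 ∧ β.1 i ≠ 0 := by
      by_contra! hcon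
      refine hβ (Subtype.ext (funext fun i => ?_))
      by_cases h : i = 1
      · subst h
        have := β.2
        rw [Finset.sum_eq_single 1 (fun i _ hi => hcon i hi) (by simp)] at this
        simp [baseChart, this]
      · simp [baseChart, h, hcon i h]
    rw [Finset.prod_eq_zero (Finset.mem_univ i), mul_zero]
    simp [hi, hi']
  · simp

theorem eval_eq_aeval (y : Fin (n + 2) → ℂ) (P : MvPolynomial (Fin (n + 2)) ℂ) :
    eval y P = aeval y P := by
  rw [aeval_eq_eval]

theorem shearData_baseChart_α {φ : Fin (n + 2) → ℂ} (hφ : φ 1 = 1) (v : Fin (n + 2) → ℂ)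
    (w : Homog n d) (ε : ℂ) : (shearData φ v w ε).2 (baseChart n d).α =
      eval (fun i => (Pi.single 1 1 : Fin (n + 2) → ℂ) i + ε * v i) (form w.2) := by
  rw [← eval_single_one (shearData φ v w ε).2, show (shearData φ v w ε).2 = formCoeff n d (shear φ v ε (form w.2)) from
    rfl, form_formCoeff (shear_isHomogeneous φ v ε (form_isHomogeneous _)), shear]
  rw [eval_eq_aeval, eval_eq_aeval, ← AlgHom.comp_apply, comp_aeval]
  congr 2
  funext i
  simp [linearForm, Pi.single_apply, hφ]

/-- With `φ 1 = 1` the coordinate point is sheared in the direction `v`; with `φ(z) ≠ 0` the point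
`z` itself really moves. -/
theorem exists_linear_functional {z : Fin (n + 2) → ℂ} (hz : ∃ i, z i ≠ 0) :
    ∃ φ : Fin (n + 2) → ℂ, φ 1 = 1 ∧ ∑ j, φ j * z j ≠ 0 := by
  by_cases h1 : z 1 = 0
  · obtain ⟨m, hm⟩ := hz
    have hm1 : m ≠ 1 := by rintro rfl; exact hm h1
    refine ⟨Pi.single 1 1 + Pi.single m 1, by simp [Ne.symm hm1], ?_⟩
    simpa [add_mul, Finset.sum_add_distrib, Pi.single_apply, h1] using hm
  · exact ⟨Pi.single 1 1, by simp, by simpa [Pi.single_apply] using h1⟩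

/-- As a polynomial in `ε` the value is nonzero at `ε = 1`, hence has finitely many roots. -/
theorem eventually_eval_add_mul_ne_zero (P : MvPolynomial (Fin (n + 2)) ℂ)
    (x v : Fin (n + 2) → ℂ) (h : eval (fun i => x i + v i) P ≠ 0) :
    ∀ᶠ ε in 𝓝[≠] (0 : ℂ), eval (fun i => x i + ε * v i) P ≠ 0 := by
  let q : Polynomial ℂ := aeval (fun i => Polynomial.C (x i) + Polynomial.X * Polynomial.C (v i)) P
  have hq : ∀ ε, q.eval ε = eval (fun i => x i + ε * v i) P := fun ε => by
    have : (Polynomial.aeval ε).comp (aeval fun i => Polynomial.C (x i) +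
        Polynomial.X * Polynomial.C (v i)) = aeval fun i => x i + ε * v i := by
      ext i
      simp
      exact mul_comm _ _
    rw [eval_eq_aeval, ← this, AlgHom.comp_apply, Polynomial.coe_aeval_eq_eval]
  have hq0 : q ≠ 0 := by
    intro h0
    have := hq 1
    rw [h0] at this
    simp only [Polynomial.eval_zero, one_mul] at this
    exact h this.symm
  have hfin : {ε | q.eval ε = 0}.Finite := by
    refine (q.roots.toFinset.finite_toSet).subset fun ε hε => ?_
    simpa [hq0] using hε
  have h2 := nhdsNE_le_cofinite (0 : ℂ) hfin.compl_mem_cofinite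
  filter_upwards [h2] with ε hε
  rw [← hq]
  exact hε

theorem eventually_add_mul_ne_zero {a b : ℂ} (h : a ≠ 0 ∨ b ≠ 0) :
    ∀ᶠ ε in 𝓝[≠] (0 : ℂ), a + ε * b ≠ 0 := by
  by_cases ha : a = 0
  · subst ha
    filter_upwards [self_mem_nhdsWithin] with ε hε
    simpa using ⟨hε, h.resolve_left fun h => h rfl⟩
  · have h1 : Tendsto (fun ε : ℂ => a + ε * b) (𝓝 0) (𝓝 (a + 0 * b)) :=
      Continuous.tendsto (by fun_prop) 0
    rw [zero_mul, add_zero] at h1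
    exact (h1.eventually_ne ha).filter_mono nhdsWithin_le_nhds

theorem exists_shear (w : VertRep n d) : ∃ φ v : Fin (n + 2) → ℂ, ∀ᶠ ε in 𝓝[≠] (0 : ℂ),
    (shearData φ v w.1 ε).1 0 0 ≠ 0 ∧ (shearData φ v w.1 ε).2 (baseChart n d).α ≠ 0 := by
  obtain ⟨w, hZ, hA, -⟩ := w
  obtain ⟨φ, hφ1, hφ⟩ := exists_linear_functional (z := fun i => w.1 i 0) hZ
  have hform : form w.2 ≠ 0 := fun h => hA (form_injective (h.trans (map_zero _).symm))
  -- A point off the hypersurface with nonzero coordinate of index `0`: the first property makes the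
  -- coefficient of `X_1^d` generically nonzero in `ε`, the second serves to make `Z_0(0)` nonzero.
  obtain ⟨v', hv'⟩ : ∃ v' : Fin (n + 2) → ℂ, eval v' (X 0 * form w.2) ≠ 0 := by
    by_contra! h
    exact mul_ne_zero (X_ne_zero 0) hform (MvPolynomial.funext fun x => by rw [h x, map_zero])
  rw [map_mul, eval_X] at hv'
  let v : Fin (n + 2) → ℂ := fun i => v' i - (Pi.single 1 1 : Fin (n + 2) → ℂ) i
  have hv0 : v 0 ≠ 0 := by
    simpa [v] using left_ne_zero_of_mul hv'
  have h1 := eventually_eval_add_mul_ne_zero (form w.2) (Pi.single 1 1) v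
    (by simpa [v] using right_ne_zero_of_mul hv')
  have h2 : ∀ᶠ ε in 𝓝[≠] (0 : ℂ), w.1 0 0 +
      ε * ((∑ j, φ j * v j) * w.1 0 0 - v 0 * ∑ j, φ j * w.1 j 0) ≠ 0 := by
    refine eventually_add_mul_ne_zero ?_
    by_cases h0 : w.1 0 0 = 0
    · right
      rw [h0, mul_zero, zero_sub]
      exact neg_ne_zero.2 (mul_ne_zero hv0 hφ)
    · exact Or.inl h0
  refine ⟨φ, v, ?_⟩
  filter_upwards [h1, h2] with ε hε1 hε2
  refine ⟨?_, by rwa [shearData_baseChart_α hφ1]⟩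
  convert hε2 using 1
  simp only [shearData]
  ring

/-- One inclusion holds because proportionality is a closed condition on representatives and is
invariant. For the other, the shears preserve proportionality and the equations, tend to the
identity, and for small `ε ≠ 0` bring the jet into the base chart. -/
theorem mk_mem_badSet_iff (hn : 1 ≤ n) (w : VertRep n d) :
    Quotient.mk (vertSetoid n d) w ∈ badSet n d ↔ FirstOrderParallel w.1 := by
  constructor
  · intro h
    let C : Set (VertJet n d) :=
      {x | ∀ w : VertRep n d, Quotient.mk (vertSetoid n d) w = x → FirstOrderParallel w.1}
    have hpre : Quotient.mk (vertSetoid n d) ⁻¹' C = {w | FirstOrderParallel w.1} := by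
      ext w
      exact ⟨fun h => h w rfl, fun h w' hw' => h.of_homogRel hn (Quotient.exact hw'.symm)⟩
    have hclosed : IsClosed C := by
      have h1 : IsClosed (Quotient.mk (vertSetoid n d) ⁻¹' C) := by
        rw [hpre]
        simp only [FirstOrderParallel, Set.ofPred_forall]
        exact isClosed_iInter fun i => isClosed_iInter fun j =>
          isClosed_eq (by fun_prop) (by fun_prop)
      exact isClosed_coinduced.2 h1
    have hsub : badSet n d ⊆ C := by
      refine closure_minimal ?_ hclosed
      rintro _ ⟨p, hp, rfl⟩ w' hw'
      exact ((firstOrderParallel_incl hn _ _).2 hp).of_homogRel hn (Quotient.exact hw'.symm)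
    exact hsub h w rfl
  · intro hw
    refine mem_closure_iff.2 fun U hU hwU => ?_
    obtain ⟨O, hO, hOU⟩ : IsOpen (Quotient.mk (vertSetoid n d) ⁻¹' U) := isOpen_coinduced.1 hU
    obtain ⟨φ, v, hev⟩ := exists_shear w
    have h1 : ∀ᶠ ε in 𝓝[≠] (0 : ℂ), shearData φ v w.1 ε ∈ O := by
      refine (((continuous_shearData φ v w.1).tendsto 0).eventually ?_).filter_mono
        nhdsWithin_le_nhds
      rw [shearData_zero]
      refine hO.mem_nhds ?_
      have : w ∈ Subtype.val ⁻¹' O := by rw [hOU]; exact hwU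
      exact this
    obtain ⟨ε, ⟨hZ, hA⟩, hεO⟩ := (hev.and h1).exists
    have heqn : ∀ k, eqn k (shearData φ v w.1 ε) = 0 := by
      rw [eqn_eq_zero_iff, evalForm_shearData, (eqn_eq_zero_iff _).1 w.2.2.2, mul_zero]
    have hrel := homogRel_incl_coord (baseChart n d) _ hZ hA
    refine ⟨Quotient.mk (vertSetoid n d) ⟨shearData φ v w.1 ε, ⟨0, hZ⟩,
      fun h => hA (congrFun h _), heqn⟩, ?_,
      ⟨coord (baseChart n d) (shearData φ v w.1 ε), eqn_eq_zero_of_homogRel hrel heqn⟩, ?_, ?_⟩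
    · have : (⟨shearData φ v w.1 ε, ⟨0, hZ⟩, fun h => hA (congrFun h _), heqn⟩ : VertRep n d) ∈
          Subtype.val ⁻¹' O := hεO
      rw [hOU] at this
      exact this
    · exact (firstOrderParallel_incl hn _ _).1 ((hw.shearData φ v ε).of_homogRel hn hrel)
    · exact Quotient.sound ((homogRel_equivalence n d).symm hrel)

theorem chartPoint_mem_badSet_iff (hn : 1 ≤ n) (c : Chart n d) (p : chartLocus c) :
    chartPoint c p ∈ badSet n d ↔ FirstOrderVanish p.1 :=
  (mk_mem_badSet_iff hn _).trans (firstOrderParallel_incl hn c p.1)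

theorem exists_coeff_one_ne_zero {c : Chart n d} {p : ChartSpace c} (h : ¬FirstOrderVanish p) :
    ∃ v, v ≠ c.υ ∧ JetRing.coeff 1 ((inclJets c p).1 v) ≠ 0 := by
  simp only [FirstOrderVanish, not_forall] at h
  obtain ⟨⟨i, hi⟩, h⟩ := h
  refine ⟨i, hi, ?_⟩
  rw [inclJets, coeff_jets]
  simpa [incl, hi] using h

/-! ### Bases of sections and the conclusion -/

theorem exists_basis_of_span_range {ι V : Type*} [AddCommGroup V] [Module ℂ V] (f : ι → V)
    {S : Submodule ℂ V} [FiniteDimensional ℂ V] (hf : Submodule.span ℂ (Set.range f) = S)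
    {m : ℕ} (hm : Module.finrank ℂ S = m) :
    ∃ T : Fin m → ι, LinearIndependent ℂ fun j => f (T j) := by
  subst hf hm
  obtain ⟨g, hg, -, hli⟩ := Submodule.exists_fun_fin_finrank_span_eq ℂ (Set.range f)
  choose T hT using hg
  exact ⟨T, by simpa only [hT] using hli⟩

/-- The values in the first chart are the images of those in the second under a single linear map,
and independence of images implies independence of the vectors; invertibility of that map is not
needed. -/
theorem TwistedField.linearIndependent_of_chartPoint_eq {a b : ℕ} {ι : Type*}
    (T : ι → TwistedField n d a b) {c c' : Chart n d} {p : chartLocus c} {q : chartLocus c'}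
    (h : chartPoint c p = chartPoint c' q)
    (hT : LinearIndependent ℂ fun j => (T j).val c p) :
    LinearIndependent ℂ fun j => (T j).val c' q := by
  have h1 : (fun j => (T j).val c p) = _ := funext fun j => (T j).compat c' c q p h.symm
  rw [h1] at hT
  exact LinearIndependent.of_comp (((((incl c' q.1).1 c.υ 0) ^ a)⁻¹ *
    (((incl c' q.1).2 c.α) ^ b)⁻¹) • (fderiv ℂ (trans c' c) q.1).toLinearMap) hT

end VertJets

end

theorem mainTheorem1 (n d : ℕ) (hn : 1 ≤ n) (hd : n < d) :
    (∀ (c : Chart n d) (p : chartLocus c),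
      chartPoint c p ∈ badSet n d ↔ FirstOrderVanish p.1) ∧
    ∀ x : VertJet n d, x ∉ badSet n d →
      (∀ (c : Chart n d) (p : chartLocus c), chartPoint c p = x →
        IsComplexSubmanifoldAt (chartLocus c) p.1 (paramDim n d + n * (n + 1)) (n + 1) ∧
        Module.finrank ℂ (tangentSpace c p.1) = paramDim n d + n * (n + 1)) ∧
      ∃ T : Fin (paramDim n d + n * (n + 1)) → TwistedField n d (n ^ 2 + 2 * n) 1,
        ∀ (c : Chart n d) (p : chartLocus c), chartPoint c p = x →
          LinearIndependent ℂ (fun j => (T j).val c p) ∧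
          Submodule.span ℂ (Set.range fun j => (T j).val c p) = tangentSpace c p.1 := by
  refine ⟨chartPoint_mem_badSet_iff hn, fun x hx => ?_⟩
  have hgood : ∀ (c : Chart n d) (p : chartLocus c), chartPoint c p = x →
      ∃ v, v ≠ c.υ ∧ JetRing.coeff 1 ((inclJets c p.1).1 v) ≠ 0 := by
    rintro c p rfl
    exact exists_coeff_one_ne_zero fun h => hx ((chartPoint_mem_badSet_iff hn c p).2 h)
  have hfin : ∀ (c : Chart n d) (p : chartLocus c), chartPoint c p = x →
      Module.finrank ℂ (tangentSpace c p.1) = paramDim n d + n * (n + 1) := by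
    intro c p hp
    obtain ⟨v, -, hv⟩ := hgood c p hp
    exact finrank_tangentSpace (linForm_varIncl_surjective hn hd.le p.2 hv)
  refine ⟨fun c p hp => ⟨?_, hfin c p hp⟩, ?_⟩
  · obtain ⟨v, -, hv⟩ := hgood c p hp
    exact isComplexSubmanifoldAt_chartLocus (linForm_varIncl_surjective hn hd.le p.2 hv)
  · obtain ⟨c₀, p₀, rfl⟩ := exists_chartPoint x
    obtain ⟨v, hvυ, hv⟩ := hgood c₀ p₀ rfl
    -- The sections are chosen in one chart through `x`; independence transfers to every other
    -- chart, where the dimension count turns it into spanning.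
    obtain ⟨T, hT⟩ := exists_basis_of_span_range _ (span_val_eq_tangentSpace hn hd p₀ hvυ hv)
      (hfin c₀ p₀ rfl)
    refine ⟨T, fun c p hp => ?_⟩
    have hli := TwistedField.linearIndependent_of_chartPoint_eq T hp.symm hT
    refine ⟨hli, Submodule.eq_of_le_of_finrank_eq (Submodule.span_le.2 ?_) ?_⟩
    · rintro _ ⟨j, rfl⟩
      exact (T j).tangent c p
    · rw [finrank_span_eq_card hli, Fintype.card_fin, hfin c p hp]
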